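/- A \emph{simple orthogonal polygon with $n$ vertices} is a compact region $P\subset\mathbb{R}^2$ (equal to the closure of its interior) whose boundary is a simple closed polygonal curve with $n$ vertices and with alternately horizontal and vertical edges; such polygons exist exactly for even $n\ge 4$. For $p,q\in P$, the point $q$ is \emph{r-visible} from $p$ if the closed axis-parallel rectangle spanned by $p$ and $q$ is contained in $P$; let $V^r(p)\subseteq P$ be the set of all points r-visible from $p$. A \emph{strong chromatic r-guarding of $P$ with $t$ colors} is a finite set $G\subset P$ with $\bigcup_{g\in G}V^r(g)=P$ together with a map $\gamma:G\to\{1,\dots,t\}$ such that $\gamma(g)\ne\gamma(g')$ for any two distinct $g,g'\in G$ with $V^r(g)\cap V^r(g')\neq\emptyset$. Let $\chi^r_{st}(P)$ be the least $t$ for which $P$ has a strong chromatic r-guarding with $t$ colors, and let $\chi^r_{st}(n)$ be the maximum of $\chi^r_{st}(P)$ over all simple orthogonal polygons $P$ with $n$ vertices. \textbf{Theorem.} There are absolute constants $c,C>0$ such that (a) every simple orthogonal polygon with $n$ vertices has a strong chromatic r-guarding with at most $C\log n$ colors; (b) for every even $n\ge 4$, the number $\chi^r_{st}(n)$ is finite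 and $c\log n\le\chi^r_{st}(n)\le C\log n$. That is, $\chi^r_{st}(n)\in\Theta(\log n)$. -/

import Mathlib

/-- A horizontal, non-degenerate edge from `p` to `q`. -/
def IsHorizontalEdge (p q : ℝ × ℝ) : Prop := p.2 = q.2 ∧ p.1 ≠ q.1

/-- A vertical, non-degenerate edge from `p` to `q`. -/
def IsVerticalEdge (p q : ℝ × ℝ) : Prop := p.1 = q.1 ∧ p.2 ≠ q.2

/-- `v` lists, in cyclic order, the `n` vertices of a simple closed orthogonal polygonal curve:
the edges `[v i, v (i + 1)]` are alternately horizontal and vertical, and two edges that do not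
follow one another in the cyclic order are disjoint (two consecutive ones, being perpendicular,
meet in their common vertex only). -/
structure IsSimpleOrthogonalCurve (n : ℕ) (v : ZMod n → ℝ × ℝ) : Prop where
  four_le : 4 ≤ n
  alternating : ∀ i,
    (IsHorizontalEdge (v i) (v (i + 1)) ∧ IsVerticalEdge (v (i + 1)) (v (i + 2))) ∨
    (IsVerticalEdge (v i) (v (i + 1)) ∧ IsHorizontalEdge (v (i + 1)) (v (i + 2)))
  disjoint : ∀ i j, i ≠ j → j ≠ i + 1 → i ≠ j + 1 →
    Disjoint (segment ℝ (v i) (v (i + 1))) (segment ℝ (v j) (v (j + 1)))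

/-- `P` is a simple orthogonal polygon with `n` vertices: a compact region of the plane (a compact
set that is the closure of its interior) whose boundary is a simple closed orthogonal polygonal
curve with `n` vertices. As the boundary is a single simple closed curve, `P` has no holes. -/
def IsSimpleOrthogonalPolygon (P : Set (ℝ × ℝ)) (n : ℕ) : Prop :=
  IsCompact P ∧ closure (interior P) = P ∧
    ∃ v : ZMod n → ℝ × ℝ, IsSimpleOrthogonalCurve n v ∧
      frontier P = ⋃ i, segment ℝ (v i) (v (i + 1))

/-- The closed axis-parallel rectangle spanned by `p` and `q`. -/
def spannedRect (p q : ℝ × ℝ) : Set (ℝ × ℝ) := Set.uIcc p.1 q.1 ×ˢ Set.uIcc p.2 q.2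

/-- The set of the points of `P` that are r-visible from `p`. -/
def rVisible (P : Set (ℝ × ℝ)) (p : ℝ × ℝ) : Set (ℝ × ℝ) := {q ∈ P | spannedRect p q ⊆ P}

/-- `G` is an r-guard set for `P`: a finite set of points of `P` from which all of `P` is
r-visible. -/
def IsRGuardSet (P : Set (ℝ × ℝ)) (G : Finset (ℝ × ℝ)) : Prop :=
  (G : Set (ℝ × ℝ)) ⊆ P ∧ ⋃ g ∈ G, rVisible P g = P

/-- `(G, γ)` is a strong chromatic r-guarding of `P` with colors in `Fin t`: `G` is an r-guard set,
and any two guards whose r-visibility regions meet have different colors. -/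
def IsStrongChromaticRGuarding (P : Set (ℝ × ℝ)) (t : ℕ) (G : Finset (ℝ × ℝ)) (γ : G → Fin t) :
    Prop :=
  IsRGuardSet P G ∧ ∀ g g' : G, g ≠ g' →
    (rVisible P (g : ℝ × ℝ) ∩ rVisible P (g' : ℝ × ℝ)).Nonempty → γ g ≠ γ g'

/-- `P` has a strong chromatic r-guarding with `t` colors. -/
def HasStrongChromaticRGuarding (P : Set (ℝ × ℝ)) (t : ℕ) : Prop :=
  ∃ (G : Finset (ℝ × ℝ)) (γ : G → Fin t), IsStrongChromaticRGuarding P t G γ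

/-- The least number of colors of a strong chromatic r-guarding of `P` (`⊤` if there is none). -/
noncomputable def strongChromaticNumber (P : Set (ℝ × ℝ)) : ℕ∞ :=
  ⨅ (t : ℕ) (_ : HasStrongChromaticRGuarding P t), (t : ℕ∞)

/-- The largest value of `strongChromaticNumber P` over all simple orthogonal polygons `P` with `n`
vertices (`⊤` if these values are unbounded). -/
noncomputable def maxStrongChromaticNumber (n : ℕ) : ℕ∞ :=
  ⨆ (P : Set (ℝ × ℝ)) (_ : IsSimpleOrthogonalPolygon P n), strongChromaticNumber P

/-! Upper bound. The vertex coordinates cut the plane into pixels: grid crossings, open grid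
segments and open cells. Every pixel lies inside `P` or outside it, so r-visibility becomes
containment of a rectangle of pixels in a finite set `S`. Since the boundary is one simple closed
curve, both `S` and its complement are connected (`IsPixelPolygon.connected`,
`IsPixelPolygon.compl_connected`).

Fix a pixel `r` and measure link distance from its row, with alternately vertical and horizontal
links. Visible pixels differ in depth by at most one, so two guards that see a common pixel and
whose depths agree mod 3 have equal depth. The pixels of depth `k + 1` form histograms that stand on
level `k`, in two opposite directions. Within a histogram, columns are weighted by the ruler
sequence (the 2-adic valuation of the position). Any two equal values enclose a larger one, so a run
of columns has a unique maximizing column. A guard is put at the lowest place of a column where that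
column maximizes the sequence on its run; these guards see everything (`AboveBase.exists_upGuard`).
The color of a guard is its depth mod 3, its direction and its ruler value, which makes O(log n)
colors (`exists_pixel_guarding`).

The delicate point is that guards of different histograms with the same depth and direction see no
common pixel. Otherwise a closed walk in `S` would cross some chord an odd number of times, although
a closed walk in a set with connected complement crosses every chord evenly (`PixelWalk.chord_eq`,
`PixelJoined.mem_chord`, `exists_mem_baseRun`).

Lower bound. Take the histogram whose floor heights are the ruler sequence. In a dyadic block, the
guard that sees the floor of the highest (middle) column lies in the block and above all its floors,
so it meets the visibility region of every guard in the block. It misses one of the two half blocks,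
and induction in that half yields a clique of logarithmic size (`exists_pairwise_conflict`). -/

/-! ### Adjacency and paths of pixels. -/

/-- Two pixels (elements of `ℤ × ℤ`) are adjacent when they share a side. -/
def PixelAdj (p q : ℤ × ℤ) : Prop :=
  (p.1 = q.1 ∧ (p.2 = q.2 + 1 ∨ q.2 = p.2 + 1)) ∨ (p.2 = q.2 ∧ (p.1 = q.1 + 1 ∨ q.1 = p.1 + 1))

theorem PixelAdj.symm {p q : ℤ × ℤ} (h : PixelAdj p q) : PixelAdj q p := by
  unfold PixelAdj at *; omega

/-- `p` and `q` are joined by a path of adjacent pixels of `X`. -/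
def PixelJoined (X : Set (ℤ × ℤ)) : ℤ × ℤ → ℤ × ℤ → Prop :=
  Relation.ReflTransGen fun p q => PixelAdj p q ∧ p ∈ X ∧ q ∈ X

/-- Any two pixels of `X` are joined by a path in `X`. -/
def PixelConnected (X : Set (ℤ × ℤ)) : Prop := ∀ p ∈ X, ∀ q ∈ X, PixelJoined X p q

namespace PixelJoined

variable {X Y : Set (ℤ × ℤ)} {p q r : ℤ × ℤ}

theorem refl : PixelJoined X p p := Relation.ReflTransGen.refl

theorem trans (h : PixelJoined X p q) (h' : PixelJoined X q r) : PixelJoined X p r :=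
  Relation.ReflTransGen.trans h h'

theorem symm (h : PixelJoined X p q) : PixelJoined X q p :=
  haveI : Std.Symm fun p q : ℤ × ℤ => PixelAdj p q ∧ p ∈ X ∧ q ∈ X :=
    ⟨fun _ _ h => ⟨h.1.symm, h.2.2, h.2.1⟩⟩
  Relation.ReflTransGen.stdSymm.symm _ _ h

theorem mono (hXY : X ⊆ Y) (h : PixelJoined X p q) : PixelJoined Y p q :=
  Relation.ReflTransGen.mono (fun _ _ h => ⟨h.1, hXY h.2.1, hXY h.2.2⟩) _ _ h

theorem of_adj (h : PixelAdj p q) (hp : p ∈ X) (hq : q ∈ X) : PixelJoined X p q :=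
  Relation.ReflTransGen.single ⟨h, hp, hq⟩

theorem row_of_le {x x' y : ℤ} (hx : x ≤ x') (h : ∀ t, x ≤ t → t ≤ x' → (t, y) ∈ X) :
    PixelJoined X (x, y) (x', y) := by
  induction x', hx using Int.leInduction with
  | base => exact refl
  | succ k hk ih =>
    exact (ih fun t h1 h2 => h t h1 (by omega)).trans
      (of_adj (by simp [PixelAdj]) (h k hk (by omega)) (h (k + 1) (by omega) le_rfl))

theorem column_of_le {x y y' : ℤ} (hy : y ≤ y') (h : ∀ t, y ≤ t → t ≤ y' → (x, t) ∈ X) :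
    PixelJoined X (x, y) (x, y') := by
  induction y', hy using Int.leInduction with
  | base => exact refl
  | succ k hk ih =>
    exact (ih fun t h1 h2 => h t h1 (by omega)).trans
      (of_adj (by simp [PixelAdj]) (h k hk (by omega)) (h (k + 1) (by omega) le_rfl))

theorem row {x x' y : ℤ} (h : ∀ t ∈ Set.uIcc x x', (t, y) ∈ X) :
    PixelJoined X (x, y) (x', y) := by
  rcases le_total x x' with hx | hx
  · exact row_of_le hx fun t h1 h2 => h t (Set.mem_uIcc.2 (by omega))
  · exact (row_of_le hx fun t h1 h2 => h t (Set.mem_uIcc.2 (by omega))).symm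

theorem column {x y y' : ℤ} (h : ∀ t ∈ Set.uIcc y y', (x, t) ∈ X) :
    PixelJoined X (x, y) (x, y') := by
  rcases le_total y y' with hx | hx
  · exact column_of_le hx fun t h1 h2 => h t (Set.mem_uIcc.2 (by omega))
  · exact (column_of_le hx fun t h1 h2 => h t (Set.mem_uIcc.2 (by omega))).symm

end PixelJoined

/-! ### Crossing parities of closed walks, a discrete Jordan argument. -/

/-- The indicator of the event that the step from `p` to `q` is vertical, between the rows `e.2` and
`e.2 + 1`, and to the right of `e`. -/
def pixelCrossing (p q e : ℤ × ℤ) : ZMod 2 :=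
  if p.1 = q.1 ∧ e.1 < p.1 ∧ min p.2 q.2 = e.2 then 1 else 0

/-- `PixelWalk S p q w`: some walk in `S` leads from `p` to `q`, and `w e` is the parity of the number
of its vertical steps between the rows `e.2` and `e.2 + 1` to the right of `e`. -/
inductive PixelWalk (S : Set (ℤ × ℤ)) (p : ℤ × ℤ) : ℤ × ℤ → (ℤ × ℤ → ZMod 2) → Prop
  | refl : PixelWalk S p p 0
  | step {q r : ℤ × ℤ} {w : ℤ × ℤ → ZMod 2} : PixelWalk S p q w → PixelAdj q r → q ∈ S → r ∈ S →
      PixelWalk S p r (w + pixelCrossing q r)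

namespace PixelWalk

variable {S X : Set (ℤ × ℤ)} {p q r : ℤ × ℤ} {w w' : ℤ × ℤ → ZMod 2}

theorem trans (h : PixelWalk S p q w) (h' : PixelWalk S q r w') : PixelWalk S p r (w + w') := by
  induction h' with
  | refl => simpa using h
  | step _ h2 h3 h4 ih => rw [← add_assoc]; exact ih.step h2 h3 h4

/-- The two counts differ only by the steps in column `x`, and these are impossible because one of
their two pixels is missing. -/
theorem left_eq (h : PixelWalk S p q w) {x y : ℤ} (hxy : (x, y) ∉ S ∨ (x, y + 1) ∉ S) :
    w (x - 1, y) = w (x, y) := by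
  induction h with
  | refl => rfl
  | @step q r w _ h2 h3 h4 ih =>
    have : pixelCrossing q r (x - 1, y) = pixelCrossing q r (x, y) := by
      obtain ⟨q1, q2⟩ := q
      obtain ⟨r1, r2⟩ := r
      have key : ¬ (q1 = x ∧ r1 = x ∧ min q2 r2 = y) := by
        rintro ⟨rfl, rfl, h⟩
        unfold PixelAdj at h2
        have : (q2 = y ∧ r2 = y + 1) ∨ (r2 = y ∧ q2 = y + 1) := by simp at h2; omega
        rcases this with ⟨rfl, rfl⟩ | ⟨rfl, rfl⟩ <;> tauto
      unfold pixelCrossing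
      simp only
      congr 1
      apply propext
      omega
    simp [ih, this]

/-- Since `(x, y)` is missing, the walk enters or leaves the part of row `y` to the right of `x` by
vertical steps only. The number of such passages is odd exactly when one of the two ends of the walk
lies on that part. -/
theorem below_eq (h : PixelWalk S p q w) {x y : ℤ} (hxy : (x, y) ∉ S) :
    w (x, y) + w (x, y - 1) =
      (if p.2 = y ∧ x < p.1 then 1 else 0) + (if q.2 = y ∧ x < q.1 then 1 else 0) := by
  induction h with
  | refl => simp [CharTwo.add_self_eq_zero]
  | @step q r w _ h2 h3 h4 ih =>
    have : pixelCrossing q r (x, y) + pixelCrossing q r (x, y - 1) =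
        (if q.2 = y ∧ x < q.1 then 1 else 0) + (if r.2 = y ∧ x < r.1 then 1 else 0) := by
      obtain ⟨q1, q2⟩ := q
      obtain ⟨r1, r2⟩ := r
      have hq : ¬ (q1 = x ∧ q2 = y) := by rintro ⟨rfl, rfl⟩; exact hxy h3
      have hr : ¬ (r1 = x ∧ r2 = y) := by rintro ⟨rfl, rfl⟩; exact hxy h4
      unfold PixelAdj at h2
      unfold pixelCrossing
      simp only at h2 ⊢
      split_ifs <;> first | omega | rfl
    have h0 : ∀ a : ZMod 2, a + a = 0 := CharTwo.add_self_eq_zero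
    simp only [Pi.add_apply]
    linear_combination ih + this + h0 (if q.2 = y ∧ x < q.1 then 1 else 0)

theorem eq_zero_of_right (h : PixelWalk S p q w) {M : ℤ} (hM : ∀ c ∈ S, c.1 ≤ M) {e : ℤ × ℤ}
    (he : M ≤ e.1) : w e = 0 := by
  induction h with
  | refl => rfl
  | @step q r w _ h2 h3 h4 ih =>
    have := hM q h3
    simp only [Pi.add_apply, ih, pixelCrossing, zero_add]
    rw [if_neg]
    omega

/-- The walk is regarded in `S` so that it can be concatenated with others, but it keeps the
information that it only crosses where both pixels belong to the smaller set `X`. -/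
theorem exists_of_joined (hX : X ⊆ S) (h : PixelJoined X p q) :
    ∃ w, PixelWalk S p q w ∧ ∀ x₁ x₂ y : ℤ, x₁ ≤ x₂ →
      (∀ s, x₁ < s → s ≤ x₂ → ¬ ((s, y) ∈ X ∧ (s, y + 1) ∈ X)) → w (x₁, y) = w (x₂, y) := by
  induction h with
  | refl => exact ⟨0, .refl, fun _ _ _ _ _ => rfl⟩
  | @tail q r _ h2 ih =>
    obtain ⟨w, hw, hw'⟩ := ih
    refine ⟨_, hw.step h2.1 (hX h2.2.1) (hX h2.2.2), fun x₁ x₂ y h12 hs => ?_⟩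
    have : pixelCrossing q r (x₁, y) = pixelCrossing q r (x₂, y) := by
      obtain ⟨q1, q2⟩ := q
      obtain ⟨r1, r2⟩ := r
      have key : ¬ (q1 = r1 ∧ x₁ < q1 ∧ q1 ≤ x₂ ∧ min q2 r2 = y) := by
        rintro ⟨rfl, h3, h4, h5⟩
        obtain ⟨h2, h6, h7⟩ := h2
        unfold PixelAdj at h2
        have : (q2 = y ∧ r2 = y + 1) ∨ (r2 = y ∧ q2 = y + 1) := by simp at h2; omega
        rcases this with ⟨rfl, rfl⟩ | ⟨rfl, rfl⟩
        · exact hs q1 h3 h4 ⟨h6, h7⟩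
        · exact hs q1 h3 h4 ⟨h7, h6⟩
      unfold pixelCrossing
      simp only
      congr 1
      apply propext
      omega
    simp [hw' x₁ x₂ y h12 hs, this]

/-- A closed walk in a bounded set of pixels with connected complement winds evenly around each pixel
of the complement. -/
theorem eq_zero_of_notMem (h : PixelWalk S p p w) {M : ℤ} (hM : ∀ c ∈ S, c.1 ≤ M)
    (hE : PixelConnected Sᶜ) {e : ℤ × ℤ} (he : e ∉ S) : w e = 0 := by
  have hfar : (M + 1, (0 : ℤ)) ∈ Sᶜ := fun h => by have := hM _ h; simp at this
  -- The parity is constant along paths in the complement, and it vanishes far to the right.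
  have key : ∀ a b : ℤ × ℤ, PixelJoined Sᶜ a b → w a = w b := by
    intro a b hab
    induction hab with
    | refl => rfl
    | @tail b c _ hbc ih =>
      rw [ih]
      have hv : ∀ x y : ℤ, (x, y) ∉ S → w (x, y) = w (x, y - 1) := fun x y hxy => by
        have := h.below_eq hxy
        rwa [CharTwo.add_self_eq_zero, CharTwo.add_eq_zero] at this
      obtain ⟨b1, b2⟩ := b
      obtain ⟨c1, c2⟩ := c
      obtain ⟨hadj, hb, hc⟩ := hbc
      rcases hadj with ⟨h1, h2 | h2⟩ | ⟨h1, h2 | h2⟩ <;> simp only at h1 h2 <;> subst h1 h2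
      · simpa using hv _ _ hb
      · simpa using (hv _ _ hc).symm
      · simpa using (h.left_eq (.inl hb)).symm
      · simpa using h.left_eq (.inl hc)
  rw [key e _ (hE e he _ hfar)]
  exact h.eq_zero_of_right hM (by simp)

end PixelWalk

/-- The left end of the chord through `x₀` between the rows `y` and `y + 1`. -/
theorem exists_left_end {S : Set (ℤ × ℤ)} {m : ℤ} (hm : ∀ c ∈ S, m ≤ c.1) (x₀ y : ℤ) :
    ∃ x₁, x₁ ≤ x₀ ∧ ((x₁, y) ∉ S ∨ (x₁, y + 1) ∉ S) ∧
      ∀ s, x₁ < s → s ≤ x₀ → (s, y) ∈ S ∧ (s, y + 1) ∈ S := by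
  obtain ⟨x₁, ⟨h1, h2⟩, h3⟩ := Int.exists_greatest_of_bdd
    (P := fun x => x ≤ x₀ ∧ ((x, y) ∉ S ∨ (x, y + 1) ∉ S)) ⟨x₀, fun z hz => hz.1⟩
    ⟨min x₀ (m - 1), min_le_left _ _, .inl fun h => by have := hm _ h; simp at this⟩
  refine ⟨x₁, h1, h2, fun s hs hs' => ?_⟩
  by_contra h
  have := h3 s ⟨hs', by tauto⟩
  omega

/-- The right end of the chord through `x₀` between the rows `y` and `y + 1`. -/
theorem exists_right_end {S : Set (ℤ × ℤ)} {M : ℤ} (hM : ∀ c ∈ S, c.1 ≤ M) (x₀ y : ℤ) :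
    ∃ x₁, x₀ ≤ x₁ ∧ ((x₁, y) ∉ S ∨ (x₁, y + 1) ∉ S) ∧
      ∀ s, x₀ ≤ s → s < x₁ → (s, y) ∈ S ∧ (s, y + 1) ∈ S := by
  obtain ⟨x₁, ⟨h1, h2⟩, h3⟩ := Int.exists_least_of_bdd
    (P := fun x => x₀ ≤ x ∧ ((x, y) ∉ S ∨ (x, y + 1) ∉ S)) ⟨x₀, fun z hz => hz.1⟩
    ⟨max x₀ (M + 1), le_max_left _ _, .inl fun h => by have := hM _ h; simp at this⟩
  refine ⟨x₁, h1, h2, fun s hs hs' => ?_⟩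
  by_contra h
  have := h3 s ⟨hs, by tauto⟩
  omega

/-- A closed walk crosses every chord an even number of times. -/
theorem PixelWalk.chord_eq {S : Set (ℤ × ℤ)} {p : ℤ × ℤ} {w : ℤ × ℤ → ZMod 2}
    (h : PixelWalk S p p w) {M : ℤ} (hM : ∀ c ∈ S, c.1 ≤ M) (hE : PixelConnected Sᶜ)
    {x₁ x₂ y : ℤ} (h1 : (x₁, y) ∉ S ∨ (x₁, y + 1) ∉ S) (h2 : (x₂, y) ∉ S ∨ (x₂, y + 1) ∉ S) :
    w (x₁, y) = w (x₂ - 1, y) := by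
  have key : ∀ x, ((x, y) ∉ S ∨ (x, y + 1) ∉ S) → w (x, y) = 0 := by
    rintro x (hx | hx)
    · exact h.eq_zero_of_notMem hM hE hx
    · have := h.below_eq hx
      rw [CharTwo.add_self_eq_zero, CharTwo.add_eq_zero] at this
      rw [← h.eq_zero_of_notMem hM hE hx, this]
      simp
  rw [h.left_eq h2, key _ h1, key _ h2]

/-- The pixels of `B` are closed under moving along rows of `S`. -/
def RowClosed (S B : Set (ℤ × ℤ)) : Prop :=
  ∀ x x' y, (x, y) ∈ B → (∀ t ∈ Set.uIcc x x', (t, y) ∈ S) → (x', y) ∈ B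

/-- A walk above the chord `y = b - 1 | b` through `x₀` that starts next to the chord does not meet
the connected set `B` on the other side, unless it ends at the chord. -/
theorem PixelJoined.mem_chord {S B : Set (ℤ × ℤ)} {m M : ℤ} (hm : ∀ c ∈ S, m ≤ c.1)
    (hM : ∀ c ∈ S, c.1 ≤ M) (hE : PixelConnected Sᶜ) (hBS : B ⊆ S) (hB : PixelConnected B)
    (hrow : RowClosed S B) {x₀ b : ℤ} (hb : (x₀, b - 1) ∈ B) (hb' : (x₀, b) ∈ S)
    (hb'' : (x₀, b) ∉ B) {p q : ℤ × ℤ} (hpath : PixelJoined (S ∩ {c | b ≤ c.2}) (x₀, b) p)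
    (hq : q ∈ B) (hpq : p = q ∨ (p.2 = b ∧ q = (p.1, b - 1))) :
    p ≠ q ∧ ∀ s ∈ Set.uIcc x₀ p.1, (s, b - 1) ∈ S ∧ (s, b) ∈ S := by
  obtain ⟨x₁, h11, h12, h13⟩ := exists_left_end hm x₀ (b - 1)
  obtain ⟨x₂, h21, h22, h23⟩ := exists_right_end hM x₀ (b - 1)
  simp only [sub_add_cancel] at h12 h13 h22 h23
  have hx1 : x₁ < x₀ := by
    rcases h11.lt_or_eq with h | rfl
    · exact h
    · exact absurd (hBS hb) (by tauto)
  have hx2 : x₀ < x₂ := by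
    rcases h21.lt_or_eq with h | rfl
    · exact h
    · exact absurd (hBS hb) (by tauto)
  -- A pixel of `B` on the upper side of the chord would, by row-closedness, bring `(x₀, b)` into
  -- `B`.
  have hnB : ∀ s, x₁ < s → s < x₂ → (s, b) ∉ B := by
    intro s h1 h2 hs
    refine hb'' (hrow s x₀ b hs fun t ht => ?_)
    rw [Set.mem_uIcc] at ht
    rcases le_total t x₀ with h | h
    · exact (h13 t (by omega) h).2
    · exact (h23 t h (by omega)).2
  obtain ⟨w₁, hw₁, hw₁'⟩ := PixelWalk.exists_of_joined Set.inter_subset_left hpath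
  obtain ⟨w₃, hw₃, hw₃'⟩ := PixelWalk.exists_of_joined hBS (hB q hq _ hb)
  have hup : PixelWalk S (x₀, b - 1) (x₀, b) (0 + pixelCrossing (x₀, b - 1) (x₀, b)) :=
    PixelWalk.refl.step (by simp [PixelAdj]) (hBS hb) hb'
  -- The walk is closed up through `B` and by a final step from `(x₀, b - 1)` to `(x₀, b)`. The
  -- first part stays in the rows from `b` on and the part in `B` avoids the upper side of the
  -- chord, so neither crosses the chord; the final step crosses it once.
  have e1 := hw₁' x₁ (x₂ - 1) (b - 1) (by omega) (fun s _ _ h => by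
    have := h.1.2
    simp at this)
  have e3 := hw₃' x₁ (x₂ - 1) (b - 1) (by omega) (fun s h1 h2 h => hnB s h1 (by omega) (by
    have := h.2
    rwa [sub_add_cancel] at this))
  have e4 : pixelCrossing (x₀, b - 1) (x₀, b) (x₁, b - 1) = 1 := by
    simp [pixelCrossing, hx1]
  have e5 : pixelCrossing (x₀, b - 1) (x₀, b) (x₂ - 1, b - 1) = 0 := by
    simp only [pixelCrossing]
    rw [if_neg (by omega)]
  by_cases hpq' : p = q
  · exfalso
    subst hpq'
    have := ((hw₁.trans hw₃).trans hup).chord_eq hM hE (x₁ := x₁) (x₂ := x₂) (y := b - 1)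
      (by simpa using h12) (by simpa using h22)
    simp [e1, e3, e4, e5] at this
  · refine ⟨hpq', ?_⟩
    obtain ⟨p1, p2⟩ := p
    obtain ⟨h1, rfl⟩ := hpq.resolve_left hpq'
    simp only at h1
    subst h1
    have hpS : (p1, p2) ∈ S := by
      rcases Relation.ReflTransGen.cases_tail hpath with h | ⟨c, -, hc⟩
      · rw [h]; exact hb'
      · exact hc.2.2.1
    have hdown : PixelWalk S (p1, p2) (p1, p2 - 1) (0 + pixelCrossing (p1, p2) (p1, p2 - 1)) :=
      PixelWalk.refl.step (by simp [PixelAdj]) hpS (hBS hq)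
    -- Parity forces a second crossing, which can only be the step down from `p` to `q`.
    have hin : x₁ < p1 ∧ p1 < x₂ := by
      by_contra hcon
      have e6 : pixelCrossing (p1, p2) (p1, p2 - 1) (x₁, p2 - 1) =
          pixelCrossing (p1, p2) (p1, p2 - 1) (x₂ - 1, p2 - 1) := by
        have : x₁ < p1 ↔ x₂ - 1 < p1 := by omega
        simp only [pixelCrossing, this]
      have := (((hw₁.trans hdown).trans hw₃).trans hup).chord_eq hM hE (x₁ := x₁) (x₂ := x₂)
        (y := p2 - 1) (by simpa using h12) (by simpa using h22)
      simp [e1, e3, e4, e5, e6] at this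
    intro s hs
    rw [Set.mem_uIcc] at hs
    simp only at hs
    rcases le_total s x₀ with h | h
    · exact h13 s (by omega) h
    · exact h23 s h (by omega)

/-- A rectangle whose boundary lies in `S` lies in `S` if the complement of `S` is connected. -/
theorem rect_subset_of_boundary {S : Set (ℤ × ℤ)} {M : ℤ} (hM : ∀ c ∈ S, c.1 ≤ M)
    (hE : PixelConnected Sᶜ) {x₁ x₂ y₁ y₂ : ℤ}
    (hl : ∀ t, y₁ ≤ t → t ≤ y₂ → (x₁, t) ∈ S) (hr : ∀ t, y₁ ≤ t → t ≤ y₂ → (x₂, t) ∈ S)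
    (hb : ∀ s, x₁ ≤ s → s ≤ x₂ → (s, y₁) ∈ S) (ht : ∀ s, x₁ ≤ s → s ≤ x₂ → (s, y₂) ∈ S)
    {s t : ℤ} (hs₁ : x₁ ≤ s) (hs₂ : s ≤ x₂) (ht₁ : y₁ ≤ t) (ht₂ : t ≤ y₂) : (s, t) ∈ S := by
  by_contra hst
  have hfar : (max M x₂ + 1, (0 : ℤ)) ∈ Sᶜ := fun h => by
    have := hM _ h
    simp only at this
    omega
  -- A path in the complement that starts in the rectangle cannot step on its boundary, so it is
  -- trapped inside.
  have key : ∀ a b : ℤ × ℤ, PixelJoined Sᶜ a b →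
      (x₁ ≤ a.1 ∧ a.1 ≤ x₂ ∧ y₁ ≤ a.2 ∧ a.2 ≤ y₂) → (x₁ ≤ b.1 ∧ b.1 ≤ x₂ ∧ y₁ ≤ b.2 ∧ b.2 ≤ y₂) := by
    intro a b hab ha
    induction hab with
    | refl => exact ha
    | @tail b c _ hbc ih =>
      obtain ⟨b1, b2⟩ := b
      obtain ⟨c1, c2⟩ := c
      obtain ⟨hadj, hbS, hc⟩ := hbc
      simp only at ih
      have h1 : b1 ≠ x₁ := by rintro rfl; exact hbS (hl _ ih.2.2.1 ih.2.2.2)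
      have h2 : b1 ≠ x₂ := by rintro rfl; exact hbS (hr _ ih.2.2.1 ih.2.2.2)
      have h3 : b2 ≠ y₁ := by rintro rfl; exact hbS (hb _ ih.1 ih.2.1)
      have h4 : b2 ≠ y₂ := by rintro rfl; exact hbS (ht _ ih.1 ih.2.1)
      unfold PixelAdj at hadj
      simp only at hadj ⊢
      omega
  have := key _ _ (hE (s, t) hst _ hfar) ⟨hs₁, hs₂, ht₁, ht₂⟩
  simp only at this
  omega

/-- The rectangle of pixels spanned by `p` and `q` lies in `S`. -/
def PixelRect (S : Set (ℤ × ℤ)) (p q : ℤ × ℤ) : Prop :=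
  ∀ s ∈ Set.uIcc p.1 q.1, ∀ t ∈ Set.uIcc p.2 q.2, (s, t) ∈ S

/-! ### The ruler sequence. -/

/-- The ruler sequence: the 2-adic valuation of `x + 1`. -/
def ruler (x : ℤ) : ℕ := padicValNat 2 (x.toNat + 1)

theorem ruler_le_log {x : ℤ} {M : ℕ} (hx : x ≤ M) : ruler x ≤ Nat.log 2 (M + 1) :=
  (padicValNat_le_nat_log _).trans (Nat.log_mono_right (by omega))

/-- With `a + 1 = 2 ^ v * i` and `b + 1 = 2 ^ v * j`, where `i < j` are odd, the even number `i + 1`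
lies strictly between them and gives a larger valuation. -/
theorem exists_ruler_lt {a b : ℤ} (ha : 0 ≤ a) (hab : a < b) (h : ruler a = ruler b) :
    ∃ c, a < c ∧ c < b ∧ ruler a < ruler c := by
  lift a to ℕ using ha
  lift b to ℕ using by omega
  simp only [ruler, Int.toNat_natCast] at h
  set v := padicValNat 2 (a + 1) with hv
  obtain ⟨i, hi⟩ : 2 ^ v ∣ a + 1 := pow_padicValNat_dvd
  obtain ⟨j, hj⟩ : 2 ^ v ∣ b + 1 := by rw [h]; exact pow_padicValNat_dvd
  have hi2 : ¬ 2 ∣ i := by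
    rintro ⟨k, rfl⟩
    exact pow_succ_padicValNat_not_dvd (p := 2) (n := a + 1) (by omega)
      ⟨k, by rw [← hv, hi]; ring⟩
  have hj2 : ¬ 2 ∣ j := by
    rintro ⟨k, rfl⟩
    exact pow_succ_padicValNat_not_dvd (p := 2) (n := b + 1) (by omega)
      ⟨k, by rw [← h, hj]; ring⟩
  have hij : i < j := by
    by_contra hcon
    have := Nat.mul_le_mul_left (2 ^ v) (not_lt.1 hcon)
    omega
  obtain ⟨k, hk⟩ : 2 ∣ i + 1 := by omega
  have hij' : i + 1 < j := by omega
  have hpos : 0 < 2 ^ v := by positivity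
  have h1 : 2 ^ v * (i + 1) < 2 ^ v * j := Nat.mul_lt_mul_of_pos_left hij' hpos
  have h2 : 2 ^ v * i < 2 ^ v * (i + 1) := Nat.mul_lt_mul_of_pos_left (by omega) hpos
  refine ⟨((2 ^ v * (i + 1) - 1 : ℕ) : ℤ), by omega, by omega, ?_⟩
  simp only [ruler, Int.toNat_natCast, ← hv]
  have h3 : 2 ^ v * (i + 1) - 1 + 1 = 2 ^ (v + 1) * k := by
    rw [Nat.sub_add_cancel (by omega), hk]; ring
  rw [h3]
  exact (padicValNat_dvd_iff_le (p := 2) (by rw [← h3]; omega)).1 (dvd_mul_right _ _)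

/-! ### Guards of the histograms that stand on a base. -/

/-- Going down from the pixel `c`, one leaves the complement of `B` for `B` below the row `b`. -/
def AboveBase (S B : Set (ℤ × ℤ)) (c : ℤ × ℤ) (b : ℤ) : Prop :=
  b ≤ c.2 ∧ (c.1, b - 1) ∈ B ∧ ∀ t, b ≤ t → t ≤ c.2 → (c.1, t) ∈ S ∧ (c.1, t) ∉ B

/-- The columns of the pixels of the row of `c` that are joined to `c` by a rectangle in `S`
reaching down below the row `b`. -/
def baseRun (S : Set (ℤ × ℤ)) (c : ℤ × ℤ) (b : ℤ) : Set ℤ :=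
  {x | ∀ s ∈ Set.uIcc c.1 x, ∀ t, b - 1 ≤ t → t ≤ c.2 → (s, t) ∈ S}

/-- The guards of the histograms that stand on `B`: the lowest pixels of their columns that
maximize the ruler sequence in their rows. -/
def IsUpGuard (S B : Set (ℤ × ℤ)) (g : ℤ × ℤ) : Prop :=
  ∃ b, AboveBase S B g b ∧ (∀ x ∈ baseRun S g b, ruler x ≤ ruler g.1) ∧
    -- The guard cannot be moved down: either it touches the base, or the wider run one row lower
    -- contains a larger ruler value.
    (g.2 = b ∨ ∃ x ∈ baseRun S (g.1, g.2 - 1) b, ruler g.1 < ruler x)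

theorem self_mem_baseRun {S B : Set (ℤ × ℤ)} (hBS : B ⊆ S) {c : ℤ × ℤ} {b : ℤ}
    (h : AboveBase S B c b) : c.1 ∈ baseRun S c b := by
  intro s hs t ht1 ht2
  simp only [Set.uIcc_self, Set.mem_singleton_iff] at hs
  subst hs
  rcases ht1.lt_or_eq with ht | rfl
  · exact (h.2.2 t (by omega) ht2).1
  · exact hBS h.2.1

theorem baseRun_trans {S : Set (ℤ × ℤ)} {c : ℤ × ℤ} {b x x' : ℤ} (hx : x ∈ baseRun S c b)
    (hx' : x' ∈ baseRun S (x, c.2) b) : x' ∈ baseRun S c b := by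
  intro s hs t ht1 ht2
  simp only [Set.mem_uIcc] at hs
  by_cases h : s ∈ Set.uIcc c.1 x
  · exact hx s h t ht1 ht2
  · refine hx' s ?_ t ht1 ht2
    simp only [Set.mem_uIcc] at h ⊢
    omega

theorem baseRun_mono {S : Set (ℤ × ℤ)} {x y y' b : ℤ} (h : y ≤ y') :
    baseRun S (x, y') b ⊆ baseRun S (x, y) b :=
  fun _ hx s hs t ht1 ht2 => hx s hs t ht1 (ht2.trans h)

/-- Row-closedness is used twice: it carries the foot of column `c.1` to column `x`, and it would
carry a pixel of `B` in column `x` back above the foot of `c`. -/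
theorem AboveBase.of_mem_baseRun {S B : Set (ℤ × ℤ)} (hrow : RowClosed S B) {c : ℤ × ℤ} {b x t : ℤ}
    (h : AboveBase S B c b) (hx : x ∈ baseRun S c b) (ht1 : b ≤ t) (ht2 : t ≤ c.2) :
    AboveBase S B (x, t) b := by
  refine ⟨ht1, hrow c.1 x _ h.2.1 fun s hs => hx s hs _ le_rfl (by have := h.1; omega), ?_⟩
  intro u hu1 hu2
  simp only at hu2
  refine ⟨hx x (by simp) u (by omega) (by omega), fun hu => ?_⟩
  refine (h.2.2 u hu1 (by omega)).2 (hrow x c.1 u hu fun s hs => ?_)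
  rw [Set.uIcc_comm] at hs
  exact hx s hs u (by omega) (by omega)

/-- Each pixel above `B` is seen by an up-guard. -/
theorem AboveBase.exists_upGuard {S B : Set (ℤ × ℤ)} {m M : ℤ} (hm : ∀ c ∈ S, m ≤ c.1)
    (hM : ∀ c ∈ S, c.1 ≤ M) (hBS : B ⊆ S) (hrow : RowClosed S B) {c : ℤ × ℤ} {b : ℤ}
    (h : AboveBase S B c b) : ∃ g ∈ S, IsUpGuard S B g ∧ PixelRect S g c := by
  have hfin : (baseRun S c b).Finite := (Set.finite_Icc m M).subset fun x hx => by
    have := hx x (by simp) c.2 (by have := h.1; omega) le_rfl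
    exact ⟨hm _ this, hM _ this⟩
  obtain ⟨x, hx, hmax⟩ := hfin.exists_maximalFor ruler _ ⟨_, self_mem_baseRun hBS h⟩
  have hmax : ∀ x' ∈ baseRun S c b, ruler x' ≤ ruler x := fun x' hx' => by
    by_contra hcon
    exact hcon (hmax hx' (by omega))
  -- In the maximizing column `x`, slide down as long as `x` stays maximal; the run only widens on
  -- the way.
  obtain ⟨t, ⟨ht1, ht2, ht3⟩, htmin⟩ := Int.exists_least_of_bdd
    (P := fun t => b ≤ t ∧ t ≤ c.2 ∧ ∀ x' ∈ baseRun S (x, t) b, ruler x' ≤ ruler x)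
    ⟨b, fun z hz => hz.1⟩ ⟨c.2, h.1, le_rfl, fun x' hx' => hmax x' (baseRun_trans hx hx')⟩
  have habove := h.of_mem_baseRun hrow hx ht1 ht2
  refine ⟨(x, t), (habove.2.2 t ht1 le_rfl).1, ⟨b, habove, ht3, ?_⟩, ?_⟩
  · by_cases htb : t = b
    · exact .inl htb
    · right
      by_contra hcon
      push Not at hcon
      have := htmin (t - 1) ⟨by omega, by omega, hcon⟩
      omega
  · intro s hs u hu
    simp only [Set.uIcc_of_le ht2, Set.mem_Icc] at hu
    rw [Set.uIcc_comm] at hs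
    exact hx s hs u (by omega) (by omega)

/-- Two up-guards with the same base whose rows overlap and with the same ruler value are equal. -/
theorem eq_of_mem_baseRun {S B : Set (ℤ × ℤ)} (h0 : ∀ c ∈ S, 0 ≤ c.1) {g g' : ℤ × ℤ} {b x : ℤ}
    (hg : AboveBase S B g b) (hg' : AboveBase S B g' b)
    (hmax : ∀ x ∈ baseRun S g b, ruler x ≤ ruler g.1)
    (hlow' : g'.2 = b ∨ ∃ x ∈ baseRun S (g'.1, g'.2 - 1) b, ruler g'.1 < ruler x)
    (hr : ruler g.1 = ruler g'.1) (hx : x ∈ baseRun S g b) (hx' : x ∈ baseRun S g' b)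
    (hle : g.2 ≤ g'.2) : g = g' := by
  -- At the lower height `g.2` both runs are available and overlap in `x`, so they join up.
  have hmem : g'.1 ∈ baseRun S g b := by
    intro s hs t ht1 ht2
    by_cases h : s ∈ Set.uIcc g.1 x
    · exact hx s h t ht1 ht2
    · refine hx' s ?_ t ht1 (ht2.trans hle)
      simp only [Set.mem_uIcc] at h hs ⊢
      omega
  have h1 : g.1 = g'.1 := by
    have hgS := h0 _ (hg.2.2 g.2 hg.1 le_rfl).1
    have hgS' := h0 _ (hg'.2.2 g'.2 hg'.1 le_rfl).1
    simp only at hgS hgS'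
    by_contra hne
    obtain ⟨c, hc, hc'⟩ : ∃ c ∈ Set.uIcc g.1 g'.1, ruler g.1 < ruler c := by
      rcases lt_or_gt_of_ne hne with h | h
      · obtain ⟨c, h1, h2, h3⟩ := exists_ruler_lt hgS h hr
        exact ⟨c, Set.mem_uIcc.2 (by omega), h3⟩
      · obtain ⟨c, h1, h2, h3⟩ := exists_ruler_lt hgS' h hr.symm
        exact ⟨c, Set.mem_uIcc.2 (by omega), hr ▸ h3⟩
    have := hmax c fun s hs => hmem s (Set.uIcc_subset_uIcc_left hc hs)
    omega
  refine Prod.ext h1 (le_antisymm hle ?_)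
  -- If `g'` were strictly higher, the larger ruler value in the run below `g'` would lie in the run
  -- of `g`.
  by_contra hcon
  rcases hlow' with h | ⟨x', hx', hlt⟩
  · have := hg.1
    omega
  · rw [← h1] at hx' hlt
    have := hmax x' (baseRun_mono (by omega : g.2 ≤ g'.2 - 1) hx')
    omega

/-- Two pixels above `B` that see a common pixel stand on the same base, and their rows
overlap. -/
theorem exists_mem_baseRun {S B : Set (ℤ × ℤ)} {m M : ℤ} (hm : ∀ c ∈ S, m ≤ c.1)
    (hM : ∀ c ∈ S, c.1 ≤ M) (hE : PixelConnected Sᶜ) (hBS : B ⊆ S) (hB : PixelConnected B)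
    (hrow : RowClosed S B) {g g' q : ℤ × ℤ} {b b' : ℤ} (hg : AboveBase S B g b)
    (hg' : AboveBase S B g' b') (hq : PixelRect S g q) (hq' : PixelRect S g' q) :
    b = b' ∧ ∃ x, x ∈ baseRun S g b ∧ x ∈ baseRun S g' b' := by
  -- If `b < b'` and `q` lies below row `b'`, a path above row `b - 1` leads from the foot of `g` to
  -- the row `max b q.2`, across to the column of `g'`, and up to the pixel `(g'.1, b' - 1)` of `B`.
  -- This is excluded by `PixelJoined.mem_chord`.
  have key : ∀ {g g' : ℤ × ℤ} {b b' : ℤ}, AboveBase S B g b → AboveBase S B g' b' →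
      PixelRect S g q → PixelRect S g' q → b < b' → q.2 < b' → False := by
    intro g g' b b' hg hg' hq hq' hbb hqb
    have hgb := (hg.2.2 b le_rfl hg.1)
    have hb1 := hg.1
    have hb1' := hg'.1
    suffices h : PixelJoined (S ∩ {c | b ≤ c.2}) (g.1, b) (g'.1, b' - 1) from
      (h.mem_chord hm hM hE hBS hB hrow hg.2.1 hgb.1 hgb.2 hg'.2.1 (.inl rfl)).1 rfl
    set y := max b q.2 with hy
    have h1 : PixelJoined (S ∩ {c | b ≤ c.2}) (g.1, b) (g.1, y) :=
      PixelJoined.column_of_le (le_max_left _ _) fun t h1 h2 => by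
        refine ⟨?_, h1⟩
        rcases le_total t g.2 with h | h
        · exact (hg.2.2 t h1 h).1
        · exact hq g.1 (by simp) t (Set.mem_uIcc.2 (by omega))
    have h2 : PixelJoined (S ∩ {c | b ≤ c.2}) (g.1, y) (q.1, y) :=
      PixelJoined.row fun t ht => ⟨hq t ht y (Set.mem_uIcc.2 (by omega)),
        (le_max_left _ _ : b ≤ y)⟩
    have h3 : PixelJoined (S ∩ {c | b ≤ c.2}) (q.1, y) (g'.1, y) :=
      PixelJoined.row fun t ht => ⟨hq' t (by rwa [Set.uIcc_comm]) y (Set.mem_uIcc.2 (by omega)),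
        (le_max_left _ _ : b ≤ y)⟩
    have h4 : PixelJoined (S ∩ {c | b ≤ c.2}) (g'.1, y) (g'.1, b' - 1) :=
      PixelJoined.column_of_le (by omega) fun t h1 h2 =>
        ⟨hq' g'.1 (by simp) t (Set.mem_uIcc.2 (by omega)), (le_max_left _ _).trans h1⟩
    exact ((h1.trans h2).trans h3).trans h4
  have hb1 := hg.1
  have hb1' := hg'.1
  by_cases hlow : q.2 < b ∨ q.2 < b'
  · have hbb : b = b' := by
      rcases lt_trichotomy b b' with h | h | h
      · exact (key hg hg' hq hq' h (by omega)).elim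
      · exact h
      · exact (key hg' hg hq' hq h (by omega)).elim
    subst hbb
    exact ⟨rfl, q.1, fun s hs t h1 h2 => hq s hs t (Set.mem_uIcc.2 (by omega)),
      fun s hs t h1 h2 => hq' s hs t (Set.mem_uIcc.2 (by omega))⟩
  · push Not at hlow
    have hcol : ∀ {g : ℤ × ℤ} {b : ℤ}, AboveBase S B g b → PixelRect S g q →
        ∀ t, b - 1 ≤ t → t ≤ max g.2 q.2 → (g.1, t) ∈ S := by
      intro g b hg hq t h1 h2
      rcases le_total t g.2 with h | h
      · exact self_mem_baseRun hBS hg g.1 (by simp) t h1 h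
      · exact hq g.1 (by simp) t (Set.mem_uIcc.2 (by omega))
    -- Here `q` is above both bases, and the path runs through the row of `q`.
    have hjoin : ∀ {g g' : ℤ × ℤ} {b b' : ℤ}, AboveBase S B g b → AboveBase S B g' b' →
        PixelRect S g q → PixelRect S g' q → b ≤ q.2 → b' ≤ q.2 → ∀ y, b ≤ y → b' ≤ y + 1 →
        y ≤ q.2 → PixelJoined (S ∩ {c | b ≤ c.2}) (g.1, b) (g'.1, y) := by
      intro g g' b b' hg hg' hq hq' h1 h2 y h3 h4 h5
      have e1 : PixelJoined (S ∩ {c | b ≤ c.2}) (g.1, b) (g.1, q.2) :=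
        PixelJoined.column_of_le h1 fun t h1 h2 => ⟨hcol hg hq t (by omega) (by omega), h1⟩
      have e2 : PixelJoined (S ∩ {c | b ≤ c.2}) (g.1, q.2) (q.1, q.2) :=
        PixelJoined.row fun t ht => ⟨hq t ht q.2 (by simp), h1⟩
      have e3 : PixelJoined (S ∩ {c | b ≤ c.2}) (q.1, q.2) (g'.1, q.2) :=
        PixelJoined.row fun t ht => ⟨hq' t (by rwa [Set.uIcc_comm]) q.2 (by simp), h1⟩
      have e4 : PixelJoined (S ∩ {c | b ≤ c.2}) (g'.1, q.2) (g'.1, y) :=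
        PixelJoined.symm <| PixelJoined.column_of_le h5 fun t h1 h2 =>
          ⟨hcol hg' hq' t (by omega) (by omega), h3.trans h1⟩
      exact ((e1.trans e2).trans e3).trans e4
    have hgb := (hg.2.2 b le_rfl hg.1)
    have hgb' := (hg'.2.2 b' le_rfl hg'.1)
    have hbb : b = b' := by
      rcases lt_trichotomy b b' with h | h | h
      · exact (((hjoin hg hg' hq hq' hlow.1 hlow.2 (b' - 1) (by omega) (by omega)
          (by omega)).mem_chord hm hM hE hBS hB hrow hg.2.1 hgb.1 hgb.2 hg'.2.1
            (.inl rfl)).1 rfl).elim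
      · exact h
      · exact (((hjoin hg' hg hq' hq hlow.2 hlow.1 (b - 1) (by omega) (by omega)
          (by omega)).mem_chord hm hM hE hBS hB hrow hg'.2.1 hgb'.1 hgb'.2 hg.2.1
            (.inl rfl)).1 rfl).elim
    subst hbb
    -- Both feet lie on one chord. With the columns of `g` and `g'` and the row of `q`, it bounds a
    -- rectangle, which is filled because the complement of `S` is connected.
    have hchord := ((hjoin hg hg' hq hq' hlow.1 hlow.2 b le_rfl (by omega) hlow.1).mem_chord
      hm hM hE hBS hB hrow hg.2.1 hgb.1 hgb.2 hg'.2.1 (.inr ⟨rfl, rfl⟩)).2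
    simp only at hchord
    have hqrow : ∀ s ∈ Set.uIcc g.1 g'.1, (s, q.2) ∈ S := by
      intro s hs
      by_cases h : s ∈ Set.uIcc g.1 q.1
      · exact hq s h _ (by simp)
      · refine hq' s ?_ _ (by simp)
        simp only [Set.mem_uIcc] at h hs ⊢
        omega
    have hfill : ∀ s ∈ Set.uIcc g.1 g'.1, ∀ t, b - 1 ≤ t → t ≤ q.2 → (s, t) ∈ S := by
      intro s hs t h1 h2
      rcases le_total g.1 g'.1 with h | h
      · rw [Set.uIcc_of_le h] at hchord hqrow hs
        exact rect_subset_of_boundary hM hE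
          (fun t h1 h2 => hcol hg hq t h1 (h2.trans (le_max_right _ _)))
          (fun t h1 h2 => hcol hg' hq' t h1 (h2.trans (le_max_right _ _)))
          (fun s h1 h2 => (hchord s ⟨h1, h2⟩).1) (fun s h1 h2 => hqrow s ⟨h1, h2⟩) hs.1 hs.2 h1 h2
      · rw [Set.uIcc_of_ge h] at hchord hqrow hs
        exact rect_subset_of_boundary hM hE
          (fun t h1 h2 => hcol hg' hq' t h1 (h2.trans (le_max_right _ _)))
          (fun t h1 h2 => hcol hg hq t h1 (h2.trans (le_max_right _ _)))
          (fun s h1 h2 => (hchord s ⟨h1, h2⟩).1) (fun s h1 h2 => hqrow s ⟨h1, h2⟩) hs.1 hs.2 h1 h2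
    have hrun : ∀ {g : ℤ × ℤ}, PixelRect S g q → ∀ x ∈ Set.uIcc g.1 q.1,
        (∀ s ∈ Set.uIcc g.1 x, ∀ t, b - 1 ≤ t → t ≤ q.2 → (s, t) ∈ S) → x ∈ baseRun S g b := by
      intro g hq x hx hx' s hs t h1 h2
      rcases le_total t q.2 with h | h
      · exact hx' s hs t h1 h
      · refine hq s (Set.uIcc_subset_uIcc_left hx hs) t (Set.mem_uIcc.2 (by omega))
    refine ⟨rfl, ?_⟩
    -- The common column is the median of `g.1`, `g'.1` and `q.1`.
    by_cases hc1 : g'.1 ∈ Set.uIcc g.1 q.1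
    · exact ⟨g'.1, hrun hq _ hc1 hfill, self_mem_baseRun hBS hg'⟩
    by_cases hc2 : g.1 ∈ Set.uIcc g'.1 q.1
    · exact ⟨g.1, self_mem_baseRun hBS hg, hrun hq' _ hc2 (by rwa [Set.uIcc_comm])⟩
    have hc3 : q.1 ∈ Set.uIcc g.1 g'.1 := by
      simp only [Set.mem_uIcc] at hc1 hc2 ⊢
      omega
    refine ⟨q.1, hrun hq _ (by simp) fun s hs => hfill s (Set.uIcc_subset_uIcc_left hc3 hs),
      hrun hq' _ (by simp) fun s hs => hfill s ?_⟩
    simp only [Set.mem_uIcc] at hc3 hs ⊢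
    omega

/-- Two up-guards with the same ruler value that see a common pixel are equal. -/
theorem IsUpGuard.eq_of_pixelRect {S B : Set (ℤ × ℤ)} {M : ℤ} (h0 : ∀ c ∈ S, 0 ≤ c.1)
    (hM : ∀ c ∈ S, c.1 ≤ M) (hE : PixelConnected Sᶜ) (hBS : B ⊆ S) (hB : PixelConnected B)
    (hrow : RowClosed S B) {g g' q : ℤ × ℤ} (hg : IsUpGuard S B g) (hg' : IsUpGuard S B g')
    (hr : ruler g.1 = ruler g'.1) (hq : PixelRect S g q) (hq' : PixelRect S g' q) : g = g' := by
  obtain ⟨b, hgb, hmax, hlow⟩ := hg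
  obtain ⟨b', hgb', hmax', hlow'⟩ := hg'
  obtain ⟨rfl, x, hx, hx'⟩ := exists_mem_baseRun h0 hM hE hBS hB hrow hgb hgb' hq hq'
  rcases le_total g.2 g'.2 with h | h
  · exact eq_of_mem_baseRun h0 hgb hgb' hmax hlow' hr hx hx' h
  · exact (eq_of_mem_baseRun h0 hgb' hgb hmax' hlow hr.symm hx' hx h).symm

/-! ### The four directions, and hulls along lines. -/

/-- The isometries of the pixel plane that turn one of the four directions upwards: `v` tells whether
the direction is vertical, and `u` whether it is increasing. -/
def dirEquiv (v u : Bool) : ℤ × ℤ ≃ ℤ × ℤ :=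
  (if v then Equiv.refl _ else Equiv.prodComm ℤ ℤ).trans
    (Equiv.prodCongr (Equiv.refl ℤ) (if u then Equiv.refl ℤ else Equiv.neg ℤ))

/-- `p` and `q` lie in a common row, if `v` is true, or in a common column. -/
def SameLine (v : Bool) (p q : ℤ × ℤ) : Prop := if v then p.2 = q.2 else p.1 = q.1

theorem dirEquiv_fst (v u : Bool) (p : ℤ × ℤ) :
    (dirEquiv v u p).1 = if v then p.1 else p.2 := by
  cases v <;> cases u <;> simp [dirEquiv]

theorem dirEquiv_snd (v u : Bool) (p : ℤ × ℤ) :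
    (dirEquiv v u p).2 = if u then (if v then p.2 else p.1) else -(if v then p.2 else p.1) := by
  cases v <;> cases u <;> simp [dirEquiv]

theorem sameLine_iff (v u : Bool) (p q : ℤ × ℤ) :
    SameLine v p q ↔ (dirEquiv v u p).2 = (dirEquiv v u q).2 := by
  cases v <;> cases u <;> simp [dirEquiv, SameLine]

theorem sameLine_not_iff (v u : Bool) (p q : ℤ × ℤ) :
    SameLine (!v) p q ↔ (dirEquiv v u p).1 = (dirEquiv v u q).1 := by
  cases v <;> cases u <;> simp [dirEquiv, SameLine]

theorem PixelAdj.dirEquiv {p q : ℤ × ℤ} (h : PixelAdj p q) (v u : Bool) :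
    PixelAdj (dirEquiv v u p) (dirEquiv v u q) := by
  unfold PixelAdj at *
  simp only [dirEquiv_fst, dirEquiv_snd]
  cases v <;> cases u <;> simp <;> omega

theorem PixelJoined.dirEquiv {X : Set (ℤ × ℤ)} {p q : ℤ × ℤ} (h : PixelJoined X p q) (v u : Bool) :
    PixelJoined (dirEquiv v u '' X) (dirEquiv v u p) (dirEquiv v u q) :=
  Relation.ReflTransGen.lift _ (fun _ _ h => ⟨h.1.dirEquiv v u, Set.mem_image_of_mem _ h.2.1,
    Set.mem_image_of_mem _ h.2.2⟩) _ _ h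

theorem PixelConnected.dirEquiv {X : Set (ℤ × ℤ)} (h : PixelConnected X) (v u : Bool) :
    PixelConnected (dirEquiv v u '' X) := by
  rintro _ ⟨p, hp, rfl⟩ _ ⟨q, hq, rfl⟩
  exact (h p hp q hq).dirEquiv v u

theorem pixelRect_dirEquiv (v u : Bool) {S : Set (ℤ × ℤ)} {p q : ℤ × ℤ} :
    PixelRect (dirEquiv v u '' S) (dirEquiv v u p) (dirEquiv v u q) ↔ PixelRect S p q := by
  have neg_mem : ∀ a b t : ℤ, t ∈ Set.uIcc (-a) (-b) ↔ -t ∈ Set.uIcc a b := by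
    intro a b t
    simp only [Set.mem_uIcc]
    omega
  unfold PixelRect
  simp only [dirEquiv_fst, dirEquiv_snd]
  constructor
  · intro h s hs t ht
    have := h (dirEquiv v u (s, t)).1 ?_ (dirEquiv v u (s, t)).2 ?_
    · simpa using this
    · cases v <;> cases u <;> simpa [dirEquiv_fst] using by assumption
    · cases v <;> cases u <;> simp only [dirEquiv_snd, neg_mem, if_true, neg_neg,
        Bool.false_eq_true, if_false] <;> assumption
  · intro h s hs t ht
    obtain ⟨⟨a, b⟩, hab⟩ := (dirEquiv v u).surjective (s, t)
    have h1 : (dirEquiv v u (a, b)).1 = s := by rw [hab]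
    have h2 : (dirEquiv v u (a, b)).2 = t := by rw [hab]
    rw [dirEquiv_fst] at h1
    rw [dirEquiv_snd] at h2
    subst h1 h2
    rw [← hab]
    refine Set.mem_image_of_mem _ (h a ?_ b ?_) <;> revert hs ht <;> cases v <;> cases u <;>
      simp only [neg_mem, if_true, neg_neg, Bool.false_eq_true, if_false] <;> intros <;> assumption

theorem PixelRect.right_mem {S : Set (ℤ × ℤ)} {p q : ℤ × ℤ} (h : PixelRect S p q) : q ∈ S :=
  h q.1 (by simp) q.2 (by simp)

theorem PixelRect.symm {S : Set (ℤ × ℤ)} {p q : ℤ × ℤ} (h : PixelRect S p q) : PixelRect S q p :=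
  fun s hs t ht => h s (by rwa [Set.uIcc_comm]) t (by rwa [Set.uIcc_comm])

theorem PixelRect.of_subset {S : Set (ℤ × ℤ)} {p q p' q' : ℤ × ℤ} (h : PixelRect S p q)
    (h1 : p'.1 ∈ Set.uIcc p.1 q.1) (h2 : q'.1 ∈ Set.uIcc p.1 q.1) (h3 : p'.2 ∈ Set.uIcc p.2 q.2)
    (h4 : q'.2 ∈ Set.uIcc p.2 q.2) : PixelRect S p' q' :=
  fun s hs t ht => h s (Set.uIcc_subset_uIcc h1 h2 hs) t (Set.uIcc_subset_uIcc h3 h4 ht)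

/-- The pixels of the rows (or columns) of `S` that meet `B`. -/
def lineHull (v : Bool) (S B : Set (ℤ × ℤ)) : Set (ℤ × ℤ) :=
  {c | ∃ p ∈ B, SameLine v p c ∧ PixelRect S p c}

/-- `B` is closed under moving along rows (or columns) of `S`. -/
def LineClosed (v : Bool) (S B : Set (ℤ × ℤ)) : Prop :=
  ∀ p ∈ B, ∀ c, SameLine v p c → PixelRect S p c → c ∈ B

theorem lineHull_subset (v : Bool) (S B : Set (ℤ × ℤ)) : lineHull v S B ⊆ S :=
  fun _ ⟨_, _, _, h⟩ => h.right_mem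

theorem subset_lineHull (v : Bool) {S B : Set (ℤ × ℤ)} (h : B ⊆ S) : B ⊆ lineHull v S B := by
  intro c hc
  refine ⟨c, hc, by cases v <;> simp [SameLine], fun s hs t ht => ?_⟩
  simp only [Set.uIcc_self, Set.mem_singleton_iff] at hs ht
  subst hs ht
  exact h hc

theorem lineClosed_lineHull (v : Bool) (S B : Set (ℤ × ℤ)) : LineClosed v S (lineHull v S B) := by
  rintro p ⟨p', hp', hl, hr⟩ c hl' hr'
  refine ⟨p', hp', ?_, fun s hs t ht => ?_⟩
  · unfold SameLine at *
    cases v <;> simp_all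
  · by_cases h : s ∈ Set.uIcc p'.1 p.1 ∧ t ∈ Set.uIcc p'.2 p.2
    · exact hr s h.1 t h.2
    · refine hr' s ?_ t ?_ <;> unfold SameLine at hl hl' <;>
        simp only [Set.mem_uIcc] at h hs ht ⊢ <;> split_ifs at hl hl' <;> omega

theorem PixelRect.joined {v : Bool} {S X : Set (ℤ × ℤ)} {p c : ℤ × ℤ} (hl : SameLine v p c)
    (h : PixelRect S p c) (hX : ∀ d, SameLine v p d → PixelRect S p d → d ∈ X) :
    PixelJoined X p c := by
  obtain ⟨p1, p2⟩ := p
  obtain ⟨c1, c2⟩ := c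
  cases v
  · simp only [SameLine, Bool.false_eq_true, if_false] at hl
    subst hl
    refine PixelJoined.column fun t ht => hX _ (by simp [SameLine]) (h.of_subset ?_ ?_ ?_ ht) <;>
      simp
  · simp only [SameLine, if_true] at hl
    subst hl
    refine PixelJoined.row fun t ht => hX _ (by simp [SameLine]) (h.of_subset ?_ ht ?_ ?_) <;>
      simp

theorem pixelConnected_lineHull (v : Bool) {S B : Set (ℤ × ℤ)} (hBS : B ⊆ S)
    (hB : PixelConnected B) : PixelConnected (lineHull v S B) := by
  rintro c ⟨p, hp, hl, hr⟩ c' ⟨p', hp', hl', hr'⟩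
  have h1 : PixelJoined (lineHull v S B) p c := hr.joined hl fun d h h' => ⟨p, hp, h, h'⟩
  have h2 : PixelJoined (lineHull v S B) p' c' := hr'.joined hl' fun d h h' => ⟨p', hp', h, h'⟩
  exact (h1.symm.trans ((hB p hp p' hp').mono (subset_lineHull v hBS))).trans h2

/-! ### Levels of link distance. -/

/-- The pixels of `S` that can be reached from the row of `r` by at most `k` links which are
alternately vertical and horizontal. -/
def linkLevel (S : Set (ℤ × ℤ)) (r : ℤ × ℤ) : ℕ → Set (ℤ × ℤ)
  | 0 => lineHull true S {r}
  | k + 1 => lineHull (decide (Even (k + 1))) S (linkLevel S r k)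

section linkLevel

variable {S : Set (ℤ × ℤ)} {r : ℤ × ℤ}

theorem linkLevel_subset (k : ℕ) : linkLevel S r k ⊆ S := by
  cases k <;> exact lineHull_subset _ _ _

theorem linkLevel_lineClosed (k : ℕ) : LineClosed (decide (Even k)) S (linkLevel S r k) := by
  cases k
  · exact lineClosed_lineHull true S _
  · exact lineClosed_lineHull _ S _

theorem linkLevel_connected (hr : r ∈ S) (k : ℕ) : PixelConnected (linkLevel S r k) := by
  induction k with
  | zero =>
    refine pixelConnected_lineHull _ (by simpa) ?_
    rintro _ rfl _ rfl
    exact .refl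
  | succ k ih => exact pixelConnected_lineHull _ (linkLevel_subset k) ih

theorem linkLevel_mono : Monotone (linkLevel S r) :=
  monotone_nat_of_le_succ fun k => subset_lineHull _ (linkLevel_subset k)

/-- Go from `p` to `q` around a corner of the rectangle: the first leg follows a line under which
level `k` is closed, and the second leg is a link of level `k + 1`. -/
theorem PixelRect.mem_linkLevel {p q : ℤ × ℤ} {k : ℕ} (hp : p ∈ linkLevel S r k)
    (h : PixelRect S p q) : q ∈ linkLevel S r (k + 1) := by
  have hk : decide (Even (k + 1)) = !decide (Even k) := by
    by_cases h : Even k <;> simp [h, Nat.even_add_one]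
  have hclosed := linkLevel_lineClosed (S := S) (r := r) k
  by_cases hv : Even k
  · refine ⟨(q.1, p.2), hclosed p hp _ ?_ (h.of_subset ?_ ?_ ?_ ?_), ?_, h.of_subset ?_ ?_ ?_ ?_⟩ <;>
      simp [SameLine, hk, hv]
  · refine ⟨(p.1, q.2), hclosed p hp _ ?_ (h.of_subset ?_ ?_ ?_ ?_), ?_, h.of_subset ?_ ?_ ?_ ?_⟩ <;>
      simp [SameLine, hk, hv]

theorem exists_mem_linkLevel (hr : r ∈ S) (hcon : PixelConnected S) {c : ℤ × ℤ} (hc : c ∈ S) :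
    ∃ k, c ∈ linkLevel S r k := by
  have h := hcon r hr c hc
  induction h with
  | refl => exact ⟨0, subset_lineHull _ (by simpa) rfl⟩
  | @tail p q _ hpq ih =>
    obtain ⟨k, hk⟩ := ih hpq.2.1
    refine ⟨k + 1, PixelRect.mem_linkLevel hk fun s hs t ht => ?_⟩
    have : (s, t) = p ∨ (s, t) = q := by
      obtain ⟨p1, p2⟩ := p
      obtain ⟨q1, q2⟩ := q
      have := hpq.1
      simp only [PixelAdj, Set.mem_uIcc, Prod.mk.injEq] at *
      omega
    rcases this with h | h <;> rw [h]
    exacts [hpq.2.1, hpq.2.2]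

/-- The link distance from the row of `r`. -/
noncomputable def linkDepth (S : Set (ℤ × ℤ)) (r c : ℤ × ℤ) : ℕ := sInf {k | c ∈ linkLevel S r k}

theorem mem_linkLevel_linkDepth (hr : r ∈ S) (hcon : PixelConnected S) {c : ℤ × ℤ} (hc : c ∈ S) :
    c ∈ linkLevel S r (linkDepth S r c) :=
  Nat.sInf_mem (exists_mem_linkLevel hr hcon hc)

theorem linkDepth_le {c : ℤ × ℤ} {k : ℕ} (h : c ∈ linkLevel S r k) : linkDepth S r c ≤ k :=
  Nat.sInf_le h

/-- Hence the depths of two guards that see a common pixel differ by at most 2, and three residues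
separate them. -/
theorem linkDepth_le_succ (hr : r ∈ S) (hcon : PixelConnected S) {p q : ℤ × ℤ}
    (h : PixelRect S p q) : linkDepth S r q ≤ linkDepth S r p + 1 :=
  linkDepth_le (h.mem_linkLevel (mem_linkLevel_linkDepth hr hcon h.symm.right_mem))

end linkLevel

/-! ### Guards of all levels and their coloring. -/

/-- The base lies just above the highest pixel of `B` between `p` and `c`. -/
theorem exists_aboveBase {S B : Set (ℤ × ℤ)} {p c : ℤ × ℤ} (hp : p ∈ B) (hc : c ∉ B)
    (h1 : p.1 = c.1) (h2 : p.2 ≤ c.2) (h : PixelRect S p c) : ∃ b, AboveBase S B c b := by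
  obtain ⟨z, ⟨hz1, hz2, hz3⟩, hz4⟩ := Int.exists_greatest_of_bdd
    (P := fun z => p.2 ≤ z ∧ z ≤ c.2 ∧ (c.1, z) ∈ B) ⟨c.2, fun z hz => hz.2.1⟩
    ⟨p.2, le_rfl, h2, by rwa [← h1]⟩
  have hzc : z ≠ c.2 := by rintro rfl; exact hc hz3
  refine ⟨z + 1, by omega, by simpa using hz3, fun t ht1 ht2 =>
    ⟨h c.1 (by simp) t (Set.mem_uIcc.2 (by omega)), fun ht => ?_⟩⟩
  have := hz4 t ⟨by omega, ht2, ht⟩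
  omega

/-- The guards at depth `k + 1`, in the direction given by `u`. -/
def IsLevelGuard (S : Set (ℤ × ℤ)) (r : ℤ × ℤ) (k : ℕ) (u : Bool) (g : ℤ × ℤ) : Prop :=
  IsUpGuard (dirEquiv (decide (Even k)) u '' S) (dirEquiv (decide (Even k)) u '' linkLevel S r k)
    (dirEquiv (decide (Even k)) u g)

section levelGuard

variable {S : Set (ℤ × ℤ)} {r : ℤ × ℤ} {M : ℕ}

theorem dirEquiv_bounds (hS : ∀ c ∈ S, (0 ≤ c.1 ∧ c.1 ≤ M) ∧ 0 ≤ c.2 ∧ c.2 ≤ M) (v u : Bool) :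
    ∀ c ∈ dirEquiv v u '' S, 0 ≤ c.1 ∧ c.1 ≤ (M : ℤ) := by
  rintro _ ⟨c, hc, rfl⟩
  have := hS c hc
  rw [dirEquiv_fst]
  split_ifs <;> tauto

theorem rowClosed_dirEquiv {v u : Bool} {B : Set (ℤ × ℤ)} (h : LineClosed v S B) :
    RowClosed (dirEquiv v u '' S) (dirEquiv v u '' B) := by
  rintro x x' y ⟨p, hp, hpx⟩ hrow
  obtain ⟨c, hc⟩ := (dirEquiv v u).surjective (x', y)
  rw [← hc]
  refine Set.mem_image_of_mem _ (h p hp c ?_ ?_)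
  · rw [sameLine_iff v u, hpx, hc]
  · rw [← pixelRect_dirEquiv v u, hpx, hc]
    intro s hs t ht
    simp only [Set.uIcc_self, Set.mem_singleton_iff] at ht
    rw [ht]
    exact hrow s hs

theorem IsLevelGuard.eq_of_pixelRect
    (hS : ∀ c ∈ S, (0 ≤ c.1 ∧ c.1 ≤ M) ∧ 0 ≤ c.2 ∧ c.2 ≤ M) (hr : r ∈ S)
    (hE : PixelConnected Sᶜ) {k : ℕ} {u : Bool} {g g' q : ℤ × ℤ}
    (hg : IsLevelGuard S r k u g) (hg' : IsLevelGuard S r k u g')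
    (hruler : ruler (dirEquiv (decide (Even k)) u g).1 = ruler (dirEquiv (decide (Even k)) u g').1)
    (hq : PixelRect S g q) (hq' : PixelRect S g' q) : g = g' := by
  set v := decide (Even k)
  refine (dirEquiv v u).injective (IsUpGuard.eq_of_pixelRect
    (fun c hc => (dirEquiv_bounds hS v u c hc).1) (fun c hc => (dirEquiv_bounds hS v u c hc).2) ?_
    (Set.image_mono (linkLevel_subset k)) ((linkLevel_connected hr k).dirEquiv v u)
    (rowClosed_dirEquiv (linkLevel_lineClosed k)) hg hg' hruler
    ((pixelRect_dirEquiv v u).2 hq) ((pixelRect_dirEquiv v u).2 hq'))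
  rw [← Set.image_compl_eq (dirEquiv v u).bijective]
  exact hE.dirEquiv v u

/-- The last link to `c` is perpendicular to the lines under which level `k` is closed; turned
upwards, it exhibits `c` above a base in level `k`. The guard itself stands above that level in its
own column, so its depth is exactly `k + 1`. -/
theorem exists_levelGuard (hS : ∀ c ∈ S, (0 ≤ c.1 ∧ c.1 ≤ M) ∧ 0 ≤ c.2 ∧ c.2 ≤ M)
    {k : ℕ} {c : ℤ × ℤ} (hc : c ∈ linkLevel S r (k + 1)) (hc' : c ∉ linkLevel S r k) :
    ∃ g ∈ S, (∃ u, IsLevelGuard S r k u g) ∧ g ∉ linkLevel S r k ∧ g ∈ linkLevel S r (k + 1) ∧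
      PixelRect S g c := by
  obtain ⟨p, hp, hl, hrect⟩ := hc
  have hk : decide (Even (k + 1)) = !decide (Even k) := by
    by_cases h : Even k <;> simp [h, Nat.even_add_one]
  set v := decide (Even k) with hv
  rw [hk] at hl
  have habove : ∃ u b, AboveBase (dirEquiv v u '' S) (dirEquiv v u '' linkLevel S r k)
      (dirEquiv v u c) b := by
    obtain ⟨u, hu⟩ : ∃ u, (dirEquiv v u p).2 ≤ (dirEquiv v u c).2 := by
      rcases le_total (dirEquiv v true p).2 (dirEquiv v true c).2 with h | h
      · exact ⟨true, h⟩
      · refine ⟨false, ?_⟩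
        rw [dirEquiv_snd, dirEquiv_snd] at *
        simpa using h
    refine ⟨u, exists_aboveBase (Set.mem_image_of_mem _ hp) ?_ ((sameLine_not_iff v u _ _).1 hl) hu
      ((pixelRect_dirEquiv v u).2 hrect)⟩
    simpa using hc'
  obtain ⟨u, b, hb⟩ := habove
  obtain ⟨_, ⟨g, hgS, rfl⟩, hg, hgc⟩ := hb.exists_upGuard
    (fun c hc => (dirEquiv_bounds hS v u c hc).1) (fun c hc => (dirEquiv_bounds hS v u c hc).2)
    (Set.image_mono (linkLevel_subset k)) (rowClosed_dirEquiv (linkLevel_lineClosed k))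
  rw [pixelRect_dirEquiv] at hgc
  refine ⟨g, hgS, ⟨u, hg⟩, ?_, ?_, hgc⟩
  · obtain ⟨b', hb', -⟩ := hg
    have := (hb'.2.2 _ hb'.1 le_rfl).2
    simpa using this
  · obtain ⟨b', hb', -⟩ := hg
    obtain ⟨z, hz, hz'⟩ := hb'.2.1
    refine ⟨z, hz, ?_, ?_⟩
    · rw [hk, sameLine_not_iff v u, hz']
    · rw [← pixelRect_dirEquiv v u, hz']
      intro s hs t ht
      have hb1 := hb'.1
      simp only [Set.uIcc_self, Set.mem_singleton_iff] at hs
      simp only [Set.mem_uIcc] at ht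
      subst hs
      by_cases htb : t = b' - 1
      · subst htb
        rw [← hz']
        exact Set.mem_image_of_mem _ (linkLevel_subset k hz)
      · exact (hb'.2.2 t (by omega) (by omega)).1

end levelGuard

/-- A bounded connected set of pixels with connected complement has a strong chromatic guarding
with logarithmically many colors. -/
theorem exists_pixel_guarding {S : Set (ℤ × ℤ)} {M : ℕ}
    (hS : ∀ c ∈ S, (0 ≤ c.1 ∧ c.1 ≤ M) ∧ 0 ≤ c.2 ∧ c.2 ≤ M) (hne : S.Nonempty)
    (hcon : PixelConnected S) (hE : PixelConnected Sᶜ) :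
    ∃ (G : Finset (ℤ × ℤ)) (γ : ℤ × ℤ → Fin (6 * (Nat.log 2 (M + 1) + 1) + 1)),
      (∀ g ∈ G, g ∈ S) ∧ (∀ c ∈ S, ∃ g ∈ G, PixelRect S g c) ∧
      ∀ g ∈ G, ∀ g' ∈ G, ∀ q, PixelRect S g q → PixelRect S g' q → γ g = γ g' → g = g' := by
  classical
  obtain ⟨r, hr⟩ := hne
  set L := Nat.log 2 (M + 1) with hL
  have hfin : S.Finite := ((Set.finite_Icc (0 : ℤ) M).prod (Set.finite_Icc (0 : ℤ) M)).subset
    fun c hc => ⟨(hS c hc).1, (hS c hc).2⟩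
  -- Three depth residues, two directions and `L + 1` ruler values; the extra color `none` is
  -- reserved for `r`.
  let e : Option (Fin 3 × Bool × Fin (L + 1)) ≃ Fin (6 * (L + 1) + 1) :=
    Fintype.equivFinOfCardEq (by simp; ring)
  let d : ℤ × ℤ → ℕ := linkDepth S r
  -- A pixel may be a guard in both directions; it then counts for `true`. Guards other than `r`
  -- have positive depth, so the subtraction is not truncated for them.
  let u : ℤ × ℤ → Bool := fun g => decide (IsLevelGuard S r (d g - 1) true g)
  let ρ : ℤ × ℤ → ℕ := fun g => ruler (dirEquiv (decide (Even (d g - 1))) (u g) g).1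
  let γ : ℤ × ℤ → Option (Fin 3 × Bool × Fin (L + 1)) := fun g => if g = r then none else
    -- The minimum only serves to land in `Fin (L + 1)`: on `S` the ruler values are at most `L`.
    some (⟨d g % 3, Nat.mod_lt _ (by norm_num)⟩, u g, ⟨min L (ρ g), by omega⟩)
  let Q : ℤ × ℤ → Prop := fun g => g = r ∨ 0 < d g ∧ ∃ u, IsLevelGuard S r (d g - 1) u g
  refine ⟨hfin.toFinset.filter Q, fun g => e (γ g), ?_, ?_, ?_⟩
  · intro g hg
    simpa using (Finset.mem_filter.1 hg).1
  · intro c hc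
    have hmem := mem_linkLevel_linkDepth hr hcon hc
    rcases Nat.eq_zero_or_pos (linkDepth S r c) with h0 | h0
    · rw [h0] at hmem
      obtain ⟨p, rfl, -, h⟩ := hmem
      exact ⟨p, by simp [Q, hr], h⟩
    · obtain ⟨k, hk⟩ := Nat.exists_eq_succ_of_ne_zero h0.ne'
      rw [hk] at hmem
      obtain ⟨g, hgS, hg, hg1, hg2, hgc⟩ := exists_levelGuard hS hmem fun h => by
        have := linkDepth_le h
        omega
      have hdg : d g = k + 1 := by
        refine le_antisymm (linkDepth_le hg2) ?_
        by_contra hcon'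
        exact hg1 (linkLevel_mono (by omega : d g ≤ k) (mem_linkLevel_linkDepth hr hcon hgS))
      refine ⟨g, ?_, hgc⟩
      simp only [Finset.mem_filter, Set.Finite.mem_toFinset, hgS, true_and]
      exact .inr ⟨by omega, by simpa [hdg] using hg⟩
  · intro g hg g' hg' q hq hq' hγ
    simp only [Finset.mem_filter, Set.Finite.mem_toFinset] at hg hg'
    have hγ := e.injective hγ
    by_cases h1 : g = r
    · by_cases h2 : g' = r
      · rw [h1, h2]
      · simp [γ, h1, h2] at hγ
    by_cases h2 : g' = r
    · simp [γ, h1, h2] at hγ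
    simp only [γ, h1, h2, if_false, Option.some.injEq, Prod.mk.injEq, Fin.mk.injEq] at hγ
    obtain ⟨hd, hu, hρ⟩ := hγ
    have hgu : ∀ {g}, Q g → g ≠ r → 0 < d g ∧ IsLevelGuard S r (d g - 1) (u g) g := by
      rintro g (rfl | ⟨h, u', hu'⟩) hne
      · exact absurd rfl hne
      · refine ⟨h, ?_⟩
        by_cases hug : IsLevelGuard S r (d g - 1) true g
        · simp [u, hug]
        · cases u'
          · simpa [u, hug] using hu'
          · exact absurd hu' hug
    have hρL : ∀ {g}, g ∈ S → ρ g ≤ L := fun {g} hg =>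
      ruler_le_log (dirEquiv_bounds hS _ _ _ (Set.mem_image_of_mem _ hg)).2
    obtain ⟨hd0, hgg⟩ := hgu hg.2 h1
    obtain ⟨hd0', hgg'⟩ := hgu hg'.2 h2
    have e1 : d q ≤ d g + 1 := linkDepth_le_succ hr hcon hq
    have e2 : d g ≤ d q + 1 := linkDepth_le_succ hr hcon hq.symm
    have e3 : d q ≤ d g' + 1 := linkDepth_le_succ hr hcon hq'
    have e4 : d g' ≤ d q + 1 := linkDepth_le_succ hr hcon hq'.symm
    -- The depths differ by at most 2 and agree mod 3.
    have hdd : d g = d g' := by omega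
    have hρρ : ρ g = ρ g' := by
      have := hρL hg.1
      have := hρL hg'.1
      omega
    rw [← hdd, ← hu] at hgg'
    refine hgg.eq_of_pixelRect hS hr hE hgg' ?_ hq hq'
    simpa [ρ, ← hdd, ← hu] using hρρ

/-! ### Pixel polygons: the interior and the exterior are connected. -/

/-- The pixels of the edge from `w i` to `w (i + 1)`. -/
def edgePixels {n : ℕ} (w : ZMod n → ℤ × ℤ) (i : ZMod n) : Set (ℤ × ℤ) :=
  {c | c.1 ∈ Set.uIcc (w i).1 (w (i + 1)).1 ∧ c.2 ∈ Set.uIcc (w i).2 (w (i + 1)).2}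

/-- `S` is the set of the pixels of a simple orthogonal polygon whose vertices are the pixels `w i`.
Pixels with an odd coordinate stand for points on a grid line, pixels with an even one for points
strictly between two grid lines. -/
structure IsPixelPolygon (n M : ℕ) (S : Set (ℤ × ℤ)) (w : ZMod n → ℤ × ℤ) : Prop where
  bounds : ∀ c ∈ S, (0 ≤ c.1 ∧ c.1 ≤ M) ∧ 0 ≤ c.2 ∧ c.2 ≤ M
  odd_vertex : ∀ i, Odd (w i).1 ∧ Odd (w i).2
  alternating : ∀ i,
    ((w i).2 = (w (i + 1)).2 ∧ (w i).1 ≠ (w (i + 1)).1 ∧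
      (w (i + 1)).1 = (w (i + 1 + 1)).1 ∧ (w (i + 1)).2 ≠ (w (i + 1 + 1)).2) ∨
    ((w i).1 = (w (i + 1)).1 ∧ (w i).2 ≠ (w (i + 1)).2 ∧
      (w (i + 1)).2 = (w (i + 1 + 1)).2 ∧ (w (i + 1)).1 ≠ (w (i + 1 + 1)).1)
  disjoint : ∀ i j, i ≠ j → j ≠ i + 1 → i ≠ j + 1 → Disjoint (edgePixels w i) (edgePixels w j)
  edge_subset : ∀ i, edgePixels w i ⊆ S
  mem_edge_of_adj : ∀ a ∈ S, ∀ b ∉ S, PixelAdj a b → ∃ i, a ∈ edgePixels w i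
  horizontal_side : ∀ x y, Even x → (∃ i, (x, y) ∈ edgePixels w i) →
    ((x, y + 1) ∈ S ↔ (x, y - 1) ∉ S)
  vertical_side : ∀ x y, Even y → (∃ i, (x, y) ∈ edgePixels w i) →
    ((x + 1, y) ∈ S ↔ (x - 1, y) ∉ S)

namespace IsPixelPolygon

variable {n M : ℕ} {S : Set (ℤ × ℤ)} {w : ZMod n → ℤ × ℤ}

/-- Vertices have odd coordinates, so an edge through an even abscissa is horizontal and extends at
least one pixel to either side. -/
theorem exists_horizontal (h : IsPixelPolygon n M S w)
    {x y : ℤ} (hx : Even x) (hF : ∃ i, (x, y) ∈ edgePixels w i) :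
    ∃ i, (w i).2 = y ∧ (w (i + 1)).2 = y ∧ (x - 1) ∈ Set.uIcc (w i).1 (w (i + 1)).1 ∧
      (x + 1) ∈ Set.uIcc (w i).1 (w (i + 1)).1 := by
  obtain ⟨i, h1, h2⟩ := hF
  obtain ⟨k, hk⟩ := hx
  obtain ⟨a, ha⟩ := (h.odd_vertex i).1
  obtain ⟨b, hb⟩ := (h.odd_vertex (i + 1)).1
  refine ⟨i, ?_⟩
  simp only [Set.mem_uIcc] at *
  rcases h.alternating i with ⟨h3, -⟩ | ⟨h3, -⟩ <;> omega

theorem exists_vertical (h : IsPixelPolygon n M S w)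
    {x y : ℤ} (hy : Even y) (hF : ∃ i, (x, y) ∈ edgePixels w i) :
    ∃ i, (w i).1 = x ∧ (w (i + 1)).1 = x ∧ (y - 1) ∈ Set.uIcc (w i).2 (w (i + 1)).2 ∧
      (y + 1) ∈ Set.uIcc (w i).2 (w (i + 1)).2 := by
  obtain ⟨i, h1, h2⟩ := hF
  obtain ⟨k, hk⟩ := hy
  obtain ⟨a, ha⟩ := (h.odd_vertex i).2
  obtain ⟨b, hb⟩ := (h.odd_vertex (i + 1)).2
  refine ⟨i, ?_⟩
  simp only [Set.mem_uIcc] at *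
  rcases h.alternating i with ⟨h3, -⟩ | ⟨h3, -⟩ <;> omega

theorem odd_of_even_left (h : IsPixelPolygon n M S w)
    {x y : ℤ} (hx : Even x) (hF : ∃ i, (x, y) ∈ edgePixels w i) : Odd y := by
  obtain ⟨i, hi, -⟩ := h.exists_horizontal hx hF
  exact hi ▸ (h.odd_vertex i).2

theorem odd_of_even_right (h : IsPixelPolygon n M S w)
    {x y : ℤ} (hy : Even y) (hF : ∃ i, (x, y) ∈ edgePixels w i) : Odd x := by
  obtain ⟨i, hi, -⟩ := h.exists_vertical hy hF
  exact hi ▸ (h.odd_vertex i).1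

/-- Two edges in the same direction with a common pixel coincide, and two perpendicular ones with a
common pixel are consecutive. -/
theorem edge_eq_or (h : IsPixelPolygon n M S w)
    {i j : ZMod n} {c : ℤ × ℤ} (hi : c ∈ edgePixels w i) (hj : c ∈ edgePixels w j) :
    i = j ∨ j = i + 1 ∨ i = j + 1 := by
  by_contra! hcon
  exact Set.disjoint_left.1 (h.disjoint i j hcon.1 hcon.2.1 hcon.2.2) hi hj

/-- The curve does not pass twice through a crossing of grid lines. -/
theorem not_pinched (h : IsPixelPolygon n M S w) {x y : ℤ} (hx : Odd x) (hy : Odd y) :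
    ¬ ((∃ i, (x + 1, y) ∈ edgePixels w i) ∧ (∃ i, (x - 1, y) ∈ edgePixels w i) ∧
      (∃ i, (x, y + 1) ∈ edgePixels w i) ∧ (∃ i, (x, y - 1) ∈ edgePixels w i)) := by
  rintro ⟨h1, h2, h3, h4⟩
  obtain ⟨i, hi⟩ := h.exists_horizontal hx.add_one h1
  obtain ⟨i', hi'⟩ := h.exists_horizontal (hx.sub_odd odd_one) h2
  obtain ⟨j, hj⟩ := h.exists_vertical hy.add_one h3
  obtain ⟨j', hj'⟩ := h.exists_vertical (hy.sub_odd odd_one) h4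
  have pi : (x, y) ∈ edgePixels w i := ⟨by simpa using hi.2.2.1, by simp [hi.1]⟩
  have pi' : (x, y) ∈ edgePixels w i' := ⟨by simpa using hi'.2.2.2, by simp [hi'.1]⟩
  have pj : (x, y) ∈ edgePixels w j := ⟨by simp [hj.1], by simpa using hj.2.2.1⟩
  have pj' : (x, y) ∈ edgePixels w j' := ⟨by simp [hj'.1], by simpa using hj'.2.2.2⟩
  -- Consecutive edges are perpendicular, so the two horizontal arms belong to one edge, with the
  -- crossing in its interior. A vertical edge through the crossing would have to be consecutive to
  -- it, hence meet it at an end.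
  have hii : i = i' := by
    rcases h.edge_eq_or pi pi' with e | e | e
    · exact e
    · subst e
      rcases h.alternating i with ⟨-, -, -, e⟩ | ⟨-, e, -⟩
      · exact absurd (hi'.1.trans hi'.2.1.symm) e
      · exact absurd (hi.1.trans hi.2.1.symm) e
    · subst e
      rcases h.alternating i' with ⟨-, -, -, e⟩ | ⟨-, e, -⟩
      · exact absurd (hi.1.trans hi.2.1.symm) e
      · exact absurd (hi'.1.trans hi'.2.1.symm) e
  subst hii
  have hne : i ≠ j := by
    rintro rfl
    rcases h.alternating i with ⟨-, e, -⟩ | ⟨-, e, -⟩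
    · exact e (hj.1.trans hj.2.1.symm)
    · exact e (hi.1.trans hi.2.1.symm)
  simp only [Set.mem_uIcc] at hi hi' hj
  rcases (h.edge_eq_or pi pj).resolve_left hne with rfl | rfl <;> omega

/-- A step from `S` to its complement starts on the curve, so off the curve the exterior spreads
from `f` over the side `s` to `f'`. -/
theorem face_mem_iff (h : IsPixelPolygon n M S w)
    {f s f' : ℤ × ℤ} (hs : PixelAdj s f) (hs' : PixelAdj s f')
    (hsF : ¬ ∃ i, s ∈ edgePixels w i) (hf' : ¬ ∃ i, f' ∈ edgePixels w i) (hf : f ∉ S) :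
    s ∉ S ∧ f' ∉ S := by
  have h1 : s ∉ S := fun hsS => hsF (h.mem_edge_of_adj s hsS f hf hs)
  exact ⟨h1, fun hfS => hf' (h.mem_edge_of_adj f' hfS s h1 hs'.symm)⟩

theorem not_mem_edge_of_even (h : IsPixelPolygon n M S w)
    {x y : ℤ} (hx : Even x) (hy : Even y) :
    ¬ ∃ i, (x, y) ∈ edgePixels w i := fun hF =>
  Int.not_even_iff_odd.2 (h.odd_of_even_left hx hF) hy

/-- The exterior faces around a crossing of grid lines are joined in the exterior. -/
theorem faces_joined (h : IsPixelPolygon n M S w)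
    {x y : ℤ} (hx : Odd x) (hy : Odd y) {a b a' b' : ℤ}
    (ha : a = x + 1 ∨ a = x - 1) (ha' : a' = x + 1 ∨ a' = x - 1)
    (hb : b = y + 1 ∨ b = y - 1) (hb' : b' = y + 1 ∨ b' = y - 1)
    (hab : (a, b) ∉ S) (hab' : (a', b') ∉ S) : PixelJoined Sᶜ (a, b) (a', b') := by
  have ex : ∀ {a}, (a = x + 1 ∨ a = x - 1) → Even a := by
    rintro a (rfl | rfl)
    exacts [hx.add_one, hx.sub_odd odd_one]
  have ey : ∀ {a}, (a = y + 1 ∨ a = y - 1) → Even a := by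
    rintro a (rfl | rfl)
    exacts [hy.add_one, hy.sub_odd odd_one]
  have vert : ∀ {a b b' : ℤ}, (a = x + 1 ∨ a = x - 1) → (b = y + 1 ∨ b = y - 1) →
      (b' = y + 1 ∨ b' = y - 1) → (a, b) ∉ S → (¬ ∃ i, (a, y) ∈ edgePixels w i) →
      PixelJoined Sᶜ (a, b) (a, b') ∧ (a, b') ∉ S := by
    intro a b b' ha hb hb' hS hF
    have adj : ∀ {b}, (b = y + 1 ∨ b = y - 1) → PixelAdj (a, y) (a, b) := by
      rintro b (rfl | rfl) <;> simp [PixelAdj]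
    obtain ⟨h1, h2⟩ := h.face_mem_iff (adj hb) (adj hb') hF (h.not_mem_edge_of_even (ex ha) (ey hb'))
      hS
    exact ⟨(PixelJoined.of_adj (adj hb).symm hS h1).trans (PixelJoined.of_adj (adj hb') h1 h2), h2⟩
  have hor : ∀ {b a a' : ℤ}, (b = y + 1 ∨ b = y - 1) → (a = x + 1 ∨ a = x - 1) →
      (a' = x + 1 ∨ a' = x - 1) → (a, b) ∉ S → (¬ ∃ i, (x, b) ∈ edgePixels w i) →
      PixelJoined Sᶜ (a, b) (a', b) ∧ (a', b) ∉ S := by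
    intro b a a' hb ha ha' hS hF
    have adj : ∀ {a}, (a = x + 1 ∨ a = x - 1) → PixelAdj (x, b) (a, b) := by
      rintro a (rfl | rfl) <;> simp [PixelAdj]
    obtain ⟨h1, h2⟩ := h.face_mem_iff (adj ha) (adj ha') hF (h.not_mem_edge_of_even (ex ha') (ey hb))
      hS
    exact ⟨(PixelJoined.of_adj (adj ha).symm hS h1).trans (PixelJoined.of_adj (adj ha') h1 h2), h2⟩
  -- An edge has `S` on exactly one side, so between two exterior faces the common arm is not on the
  -- curve.
  have vert' : ∀ {a b b' : ℤ}, (a = x + 1 ∨ a = x - 1) → (b = y + 1 ∨ b = y - 1) →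
      (b' = y + 1 ∨ b' = y - 1) → (a, b) ∉ S → (a, b') ∉ S → PixelJoined Sᶜ (a, b) (a, b') := by
    intro a b b' ha hb hb' hS hS'
    by_cases hbb : b = b'
    · rw [hbb]
      exact .refl
    refine (vert ha hb hb' hS fun hF => ?_).1
    have := h.horizontal_side a y (ex ha) hF
    rcases hb with rfl | rfl <;> rcases hb' with rfl | rfl <;> tauto
  have hor' : ∀ {b a a' : ℤ}, (b = y + 1 ∨ b = y - 1) → (a = x + 1 ∨ a = x - 1) →
      (a' = x + 1 ∨ a' = x - 1) → (a, b) ∉ S → (a', b) ∉ S → PixelJoined Sᶜ (a, b) (a', b) := by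
    intro b a a' hb ha ha' hS hS'
    by_cases haa : a = a'
    · rw [haa]
      exact .refl
    refine (hor hb ha ha' hS fun hF => ?_).1
    have := h.vertical_side x b (ey hb) hF
    rcases ha with rfl | rfl <;> rcases ha' with rfl | rfl <;> tauto
  by_cases haa : a = a'
  · subst haa
    exact vert' ha hb hb' hab hab'
  by_cases hbb : b = b'
  · subst hbb
    exact hor' hb ha ha' hab hab'
  -- For diagonally opposite faces, some arm is off the curve; passing over it reduces to the case
  -- of neighboring faces.
  have hside : (¬ ∃ i, (a, y) ∈ edgePixels w i) ∨ (¬ ∃ i, (a', y) ∈ edgePixels w i) ∨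
      (¬ ∃ i, (x, b) ∈ edgePixels w i) ∨ (¬ ∃ i, (x, b') ∈ edgePixels w i) := by
    by_contra! hcon
    refine h.not_pinched hx hy ?_
    rcases ha with rfl | rfl <;> rcases ha' with rfl | rfl <;> rcases hb with rfl | rfl <;>
      rcases hb' with rfl | rfl <;> tauto
  rcases hside with hF | hF | hF | hF
  · obtain ⟨h1, h2⟩ := vert ha hb hb' hab hF
    exact h1.trans (hor' hb' ha ha' h2 hab')
  · obtain ⟨h1, h2⟩ := vert ha' hb' hb hab' hF
    exact (hor' hb ha ha' hab h2).trans h1.symm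
  · obtain ⟨h1, h2⟩ := hor hb ha ha' hab hF
    exact h1.trans (vert' ha' hb hb' h2 hab')
  · obtain ⟨h1, h2⟩ := hor hb' ha' ha hab' hF
    exact (vert' ha hb hb' hab h2).trans h1.symm

/-- The exterior faces around the pixel `p` are joined to `e` in the exterior. -/
def FacesJoined (S : Set (ℤ × ℤ)) (e p : ℤ × ℤ) : Prop :=
  ∀ a b, (a = p.1 + 1 ∨ a = p.1 - 1) → (b = p.2 + 1 ∨ b = p.2 - 1) → (a, b) ∉ S →
    PixelJoined Sᶜ (a, b) e

theorem facesJoined_of (h : IsPixelPolygon n M S w)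
    {e p : ℤ × ℤ} (hx : Odd p.1) (hy : Odd p.2) {a b : ℤ}
    (ha : a = p.1 + 1 ∨ a = p.1 - 1) (hb : b = p.2 + 1 ∨ b = p.2 - 1) (hab : (a, b) ∉ S)
    (he : PixelJoined Sᶜ (a, b) e) : FacesJoined S e p := fun _ _ ha' hb' hab' =>
  (h.faces_joined hx hy ha' ha hb' hb hab' hab).trans he

/-- Successive crossings on an edge share the two faces beside the pixel between them, and one of
these faces is exterior. So the property travels along the edge in steps of 2. -/
theorem facesJoined_row (h : IsPixelPolygon n M S w)
    {e : ℤ × ℤ} {x x' y : ℤ} (hx : Odd x) (hx' : Odd x') (hy : Odd y)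
    (hF : ∀ s ∈ Set.uIcc x x', ∃ i, (s, y) ∈ edgePixels w i) (hp : FacesJoined S e (x, y)) :
    FacesJoined S e (x', y) := by
  have step : ∀ x, Odd x → ∀ δ : ℤ, (δ = 1 ∨ δ = -1) → (∃ i, (x + δ, y) ∈ edgePixels w i) →
      FacesJoined S e (x, y) → FacesJoined S e (x + 2 * δ, y) := by
    intro x hx δ hδ hF hp
    have hodd : Odd (x + 2 * δ) := hx.add_even (even_two_mul δ)
    have heven : Even (x + δ) := by
      rcases hδ with rfl | rfl
      exacts [hx.add_one, hx.add_odd (by decide)]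
    obtain ⟨b, hb, hS⟩ : ∃ b, (b = y + 1 ∨ b = y - 1) ∧ (x + δ, b) ∉ S := by
      have := h.horizontal_side _ _ heven hF
      by_cases hS : (x + δ, y + 1) ∈ S
      · exact ⟨_, .inr rfl, this.1 hS⟩
      · exact ⟨_, .inl rfl, hS⟩
    exact h.facesJoined_of hodd hy (by simp only; omega) hb hS
      (hp _ _ (by simp only; omega) hb hS)
  obtain ⟨k, hk⟩ : ∃ k : ℕ, x' = x + 2 * k ∨ x' = x - 2 * k := by
    obtain ⟨a, rfl⟩ := hx
    obtain ⟨b, rfl⟩ := hx'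
    exact ⟨(a - b).natAbs, by omega⟩
  clear hx'
  induction k generalizing x with
  | zero => simpa [show x' = x by simpa using hk] using hp
  | succ k ih =>
    obtain ⟨δ, hδ, hδ'⟩ : ∃ δ : ℤ, (δ = 1 ∨ δ = -1) ∧ x' = x + 2 * (k + 1) * δ := by
      push_cast at hk
      rcases hk with hk | hk
      · exact ⟨1, .inl rfl, by omega⟩
      · exact ⟨-1, .inr rfl, by omega⟩
    have hsub : Set.uIcc (x + 2 * δ) x' ⊆ Set.uIcc x x' := by
      refine Set.uIcc_subset_uIcc_right ?_
      rw [Set.mem_uIcc]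
      rcases hδ with rfl | rfl <;> omega
    refine ih (x := x + 2 * δ) (hx.add_even (even_two_mul δ)) (fun s hs => hF s (hsub hs))
      (step x hx δ hδ (hF _ ?_) hp) ?_
    · rw [Set.mem_uIcc]
      rcases hδ with rfl | rfl <;> omega
    · rcases hδ with rfl | rfl <;> omega

theorem facesJoined_column (h : IsPixelPolygon n M S w)
    {e : ℤ × ℤ} {x y y' : ℤ} (hx : Odd x) (hy : Odd y) (hy' : Odd y')
    (hF : ∀ s ∈ Set.uIcc y y', ∃ i, (x, s) ∈ edgePixels w i) (hp : FacesJoined S e (x, y)) :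
    FacesJoined S e (x, y') := by
  have step : ∀ y, Odd y → ∀ δ : ℤ, (δ = 1 ∨ δ = -1) → (∃ i, (x, y + δ) ∈ edgePixels w i) →
      FacesJoined S e (x, y) → FacesJoined S e (x, y + 2 * δ) := by
    intro y hy δ hδ hF hp
    have hodd : Odd (y + 2 * δ) := hy.add_even (even_two_mul δ)
    have heven : Even (y + δ) := by
      rcases hδ with rfl | rfl
      exacts [hy.add_one, hy.add_odd (by decide)]
    obtain ⟨a, ha, hS⟩ : ∃ a, (a = x + 1 ∨ a = x - 1) ∧ (a, y + δ) ∉ S := by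
      have := h.vertical_side _ _ heven hF
      by_cases hS : (x + 1, y + δ) ∈ S
      · exact ⟨_, .inr rfl, this.1 hS⟩
      · exact ⟨_, .inl rfl, hS⟩
    exact h.facesJoined_of hx hodd ha (by simp only; omega) hS
      (hp _ _ ha (by simp only; omega) hS)
  obtain ⟨k, hk⟩ : ∃ k : ℕ, y' = y + 2 * k ∨ y' = y - 2 * k := by
    obtain ⟨a, rfl⟩ := hy
    obtain ⟨b, rfl⟩ := hy'
    exact ⟨(a - b).natAbs, by omega⟩
  clear hy'
  induction k generalizing y with
  | zero => simpa [show y' = y by simpa using hk] using hp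
  | succ k ih =>
    obtain ⟨δ, hδ, hδ'⟩ : ∃ δ : ℤ, (δ = 1 ∨ δ = -1) ∧ y' = y + 2 * (k + 1) * δ := by
      push_cast at hk
      rcases hk with hk | hk
      · exact ⟨1, .inl rfl, by omega⟩
      · exact ⟨-1, .inr rfl, by omega⟩
    have hsub : Set.uIcc (y + 2 * δ) y' ⊆ Set.uIcc y y' := by
      refine Set.uIcc_subset_uIcc_right ?_
      rw [Set.mem_uIcc]
      rcases hδ with rfl | rfl <;> omega
    refine ih (y := y + 2 * δ) (hy.add_even (even_two_mul δ)) (fun s hs => hF s (hsub hs))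
      (step y hy δ hδ (hF _ ?_) hp) ?_
    · rw [Set.mem_uIcc]
      rcases hδ with rfl | rfl <;> omega
    · rcases hδ with rfl | rfl <;> omega

theorem facesJoined_edge (h : IsPixelPolygon n M S w)
    {e p q : ℤ × ℤ} {i : ZMod n} (hp : p ∈ edgePixels w i)
    (hq : q ∈ edgePixels w i) (hp1 : Odd p.1) (hp2 : Odd p.2) (hq1 : Odd q.1) (hq2 : Odd q.2)
    (hpe : FacesJoined S e p) : FacesJoined S e q := by
  obtain ⟨p1, p2⟩ := p
  obtain ⟨q1, q2⟩ := q
  simp only at *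
  rcases h.alternating i with ⟨h1, -⟩ | ⟨h1, -⟩
  · have : q2 = p2 := by
      have := hp.2
      have := hq.2
      simp only [h1, Set.uIcc_self, Set.mem_singleton_iff] at *
      omega
    subst this
    exact h.facesJoined_row hp1 hq1 hp2
      (fun s hs => ⟨i, Set.uIcc_subset_uIcc hp.1 hq.1 hs, hp.2⟩) hpe
  · have : q1 = p1 := by
      have := hp.1
      have := hq.1
      simp only [h1, Set.uIcc_self, Set.mem_singleton_iff] at *
      omega
    subst this
    exact h.facesJoined_column hp1 hp2 hq2
      (fun s hs => ⟨i, hp.1, Set.uIcc_subset_uIcc hp.2 hq.2 hs⟩) hpe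

theorem vertex_mem (i : ZMod n) : w i ∈ edgePixels w i := ⟨by simp, by simp⟩

theorem vertex_succ_mem (i : ZMod n) : w (i + 1) ∈ edgePixels w i := ⟨by simp, by simp⟩

theorem zmod_induction {p : ZMod n → Prop} (hn : n ≠ 0) {i₀ : ZMod n} (h0 : p i₀)
    (hs : ∀ i, p i → p (i + 1)) (i : ZMod n) : p i := by
  have : NeZero n := ⟨hn⟩
  have key : ∀ k : ℕ, p (i₀ + k) := by
    intro k
    induction k with
    | zero => simpa using h0
    | succ k ih => simpa [add_assoc] using hs _ ih
  obtain ⟨k, hk⟩ := ZMod.natCast_zmod_surjective (i - i₀)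
  simpa [hk] using key k

theorem facesJoined_all (h : IsPixelPolygon n M S w)
    (hn : n ≠ 0) {e p : ℤ × ℤ} {i : ZMod n} (hp : p ∈ edgePixels w i)
    (hp1 : Odd p.1) (hp2 : Odd p.2) (hpe : FacesJoined S e p) {q : ℤ × ℤ} {j : ZMod n}
    (hq : q ∈ edgePixels w j) (hq1 : Odd q.1) (hq2 : Odd q.2) : FacesJoined S e q := by
  have hv := h.odd_vertex
  refine h.facesJoined_edge (vertex_mem j) hq (hv j).1 (hv j).2 hq1 hq2 ?_
  exact zmod_induction (p := fun j => FacesJoined S e (w j)) hn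
    (h.facesJoined_edge hp (vertex_mem i) hp1 hp2 (hv i).1 (hv i).2 hpe)
    (fun j hj => h.facesJoined_edge (vertex_mem j) (vertex_succ_mem j) (hv j).1 (hv j).2
      (hv (j + 1)).1 (hv (j + 1)).2 hj) j

theorem edge_joined (h : IsPixelPolygon n M S w)
    {p q : ℤ × ℤ} {i : ZMod n} (hp : p ∈ edgePixels w i)
    (hq : q ∈ edgePixels w i) : PixelJoined S p q := by
  have h1 : PixelJoined S (p.1, p.2) (q.1, p.2) := PixelJoined.row fun t ht =>
    h.edge_subset i ⟨Set.uIcc_subset_uIcc hp.1 hq.1 ht, hp.2⟩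
  exact h1.trans (PixelJoined.column fun t ht =>
    h.edge_subset i ⟨hq.1, Set.uIcc_subset_uIcc hp.2 hq.2 ht⟩)

/-- Going left from a pixel of `S`, the last pixel before leaving `S` is on the curve, and the curve
is connected. -/
theorem connected (h : IsPixelPolygon n M S w) (hn : n ≠ 0) : PixelConnected S := by
  have hw : ∀ i, PixelJoined S (w 0) (w i) := zmod_induction hn (i₀ := 0) .refl
    fun i hi => hi.trans (h.edge_joined (vertex_mem i) (vertex_succ_mem i))
  have key : ∀ c ∈ S, PixelJoined S (w 0) c := by
    rintro ⟨x, y⟩ hc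
    obtain ⟨t, ⟨ht1, ht2⟩, ht3⟩ := Int.exists_greatest_of_bdd (P := fun t => t ≤ x ∧ (t, y) ∉ S)
      ⟨x, fun z hz => hz.1⟩ ⟨-1, by have := h.bounds _ hc; simp only at this; omega,
        fun hS => by have := h.bounds _ hS; simp only at this; omega⟩
    have htx : t ≠ x := by rintro rfl; exact ht2 hc
    have hrow : ∀ s, t + 1 ≤ s → s ≤ x → (s, y) ∈ S := fun s h1 h2 => by
      by_contra hcon
      have := ht3 s ⟨h2, hcon⟩
      omega
    obtain ⟨i, hi⟩ := h.mem_edge_of_adj (t + 1, y) (hrow _ le_rfl (by omega)) (t, y) ht2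
      (by simp [PixelAdj])
    exact ((hw i).trans (h.edge_joined (vertex_mem i) hi)).trans
      (PixelJoined.row_of_le (by omega) hrow)
  exact fun p hp q hq => (key p hp).symm.trans (key q hq)

theorem exists_vertical_edge (h : IsPixelPolygon n M S w)
    : ∃ i, (w i).1 = (w (i + 1)).1 ∧ (w i).2 ≠ (w (i + 1)).2 := by
  rcases h.alternating 0 with ⟨-, -, h1⟩ | ⟨h1, h2, -⟩
  exacts [⟨_, h1⟩, ⟨_, h1, h2⟩]

/-- Going left from an exterior pixel, one leaves the bounding box of the polygon or comes next to an
edge. -/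
theorem left_joined (h : IsPixelPolygon n M S w) {x y : ℤ} (hxy : (x, y) ∉ S) :
    PixelJoined Sᶜ (x, y) (-1, 0) ∨
      ∃ s, (∃ i, (s, y) ∈ edgePixels w i) ∧ (s + 1, y) ∉ S ∧
        PixelJoined Sᶜ (x, y) (s + 1, y) := by
  by_cases hs : ∃ s, s ≤ x ∧ (s, y) ∈ S
  · right
    obtain ⟨s, ⟨h1, h2⟩, h3⟩ := Int.exists_greatest_of_bdd (P := fun s => s ≤ x ∧ (s, y) ∈ S)
      ⟨x, fun z hz => hz.1⟩ hs
    have hsx : s ≠ x := by rintro rfl; exact hxy h2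
    have hrow : ∀ t, s + 1 ≤ t → t ≤ x → (t, y) ∈ Sᶜ := fun t h4 h5 hS => by
      have := h3 t ⟨h5, hS⟩
      omega
    have hs1 : (s + 1, y) ∉ S := hrow _ le_rfl (by omega)
    exact ⟨s, h.mem_edge_of_adj _ h2 _ hs1 (by simp [PixelAdj]), hs1,
      (PixelJoined.row_of_le (by omega) hrow).symm⟩
  · left
    push Not at hs
    have h1 : PixelJoined Sᶜ (x, y) (-1, y) := PixelJoined.row fun t ht hS => by
      have := h.bounds _ hS
      rw [Set.mem_uIcc] at ht
      exact hs t (by simp only at this; omega) hS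
    exact h1.trans (PixelJoined.column fun t ht hS => by
      have := h.bounds _ hS
      simp at this)

/-- All exterior faces along the curve are joined to `(-1, 0)` as soon as this holds at one
crossing. Any exterior pixel reaches either the outside of the bounding box or such a face. -/
theorem compl_connected (h : IsPixelPolygon n M S w)
    (hn : n ≠ 0) : PixelConnected Sᶜ := by
  -- The first crossing is found next to the leftmost pixel of `S` in an even row that meets a
  -- vertical edge.
  have hface : ∃ i p, p ∈ edgePixels w i ∧ Odd p.1 ∧ Odd p.2 ∧ FacesJoined S (-1, 0) p := by
    obtain ⟨i, hi1, hi2⟩ := h.exists_vertical_edge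
    obtain ⟨y, hy1, hy2⟩ : ∃ y, y ∈ Set.uIcc (w i).2 (w (i + 1)).2 ∧ Even y := by
      obtain ⟨a, ha⟩ := (h.odd_vertex i).2
      obtain ⟨b, hb⟩ := (h.odd_vertex (i + 1)).2
      rcases lt_or_gt_of_ne hi2 with hlt | hlt
      · exact ⟨2 * a + 2, Set.mem_uIcc.2 (by omega), ⟨a + 1, by ring⟩⟩
      · exact ⟨2 * b + 2, Set.mem_uIcc.2 (by omega), ⟨b + 1, by ring⟩⟩
    obtain ⟨s, h1, h2⟩ := Int.exists_least_of_bdd (P := fun s => (s, y) ∈ S)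
      ⟨0, fun z hz => (h.bounds _ hz).1.1⟩ ⟨(w i).1, h.edge_subset i ⟨by simp, hy1⟩⟩
    have hs : (s - 1, y) ∉ S := fun hS => by
      have := h2 _ hS
      omega
    have hsF := h.mem_edge_of_adj _ h1 _ hs (by simp [PixelAdj])
    obtain ⟨j, hj1, hj2, hj3, -⟩ := h.exists_vertical hy2 hsF
    have hsodd := h.odd_of_even_right hy2 hsF
    have hyodd : Odd (y - 1) := hy2.sub_odd odd_one
    refine ⟨j, (s, y - 1), ⟨by simp [hj1, hj2], hj3⟩, hsodd, hyodd,
      h.facesJoined_of hsodd hyodd (a := s - 1) (b := y) (.inr rfl) (.inl (by simp)) hs ?_⟩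
    refine PixelJoined.trans (q := (-1, y)) ?_ (PixelJoined.column fun t ht hS => by
      have := h.bounds _ hS
      simp at this)
    refine PixelJoined.symm (PixelJoined.row_of_le ?_ fun t h3 h4 hS => ?_)
    · have := h.bounds _ h1
      simp only at this
      omega
    · have := h2 _ hS
      omega
  obtain ⟨i, p, hpi, hp1, hp2, hp⟩ := hface
  have heven : ∀ x y, Even x → Even y → (x, y) ∉ S → PixelJoined Sᶜ (x, y) (-1, 0) := by
    intro x y hx hy hxy
    rcases h.left_joined hxy with h1 | ⟨s, hsF, hs, hj⟩
    · exact h1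
    · obtain ⟨j, hj1, hj2, hj3, -⟩ := h.exists_vertical hy hsF
      have hsodd := h.odd_of_even_right hy hsF
      have hyodd : Odd (y - 1) := hy.sub_odd odd_one
      exact hj.trans (h.facesJoined_all hn hpi hp1 hp2 hp (q := (s, y - 1)) (j := j)
        ⟨by simp [hj1, hj2], hj3⟩ hsodd hyodd _ _ (.inl rfl) (.inl (by simp)) hs)
  have hrow : ∀ x y, Even y → (x, y) ∉ S → PixelJoined Sᶜ (x, y) (-1, 0) := by
    intro x y hy hxy
    by_cases hx : Even x
    · exact heven x y hx hy hxy
    · have hx1 : Even (x + 1) := (Int.not_even_iff_odd.1 hx).add_one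
      have hS : (x + 1, y) ∉ S := fun hS => h.not_mem_edge_of_even hx1 hy
        (h.mem_edge_of_adj _ hS _ hxy (by simp [PixelAdj]))
      exact (PixelJoined.of_adj (by simp [PixelAdj]) hxy hS).trans (heven _ _ hx1 hy hS)
  have key : ∀ e ∈ Sᶜ, PixelJoined Sᶜ e (-1, 0) := by
    rintro ⟨x, y⟩ hxy
    by_cases hy : Even y
    · exact hrow x y hy hxy
    · have hy1 : Even (y + 1) := (Int.not_even_iff_odd.1 hy).add_one
      have hS : (x, y + 1) ∉ S := fun hS => by
        obtain ⟨j, hj1, hj2, hj3, -⟩ := h.exists_vertical hy1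
          (h.mem_edge_of_adj _ hS _ hxy (by simp [PixelAdj]))
        exact hxy (h.edge_subset j ⟨by simp [hj1, hj2], by simpa using hj3⟩)
      exact (PixelJoined.of_adj (by simp [PixelAdj]) hxy hS).trans (hrow _ _ hy1 hS)
  exact fun p hp q hq => (key p hp).trans (key q hq).symm

end IsPixelPolygon

/-! ### Positions of real numbers relative to a finite set. -/

/-- The position of `x` relative to the finite set `X`: odd for the elements of `X`, even for the
numbers strictly between two neighboring ones. -/
noncomputable def gridIndex (X : Finset ℝ) (x : ℝ) : ℤ :=
  ((X.filter (· < x)).card : ℤ) + ((X.filter (· ≤ x)).card : ℤ)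

section gridIndex

variable {X : Finset ℝ} {x y v : ℝ}

theorem gridIndex_mono (X : Finset ℝ) : Monotone (gridIndex X) := by
  intro x y hxy
  have h1 : (X.filter (· < x)).card ≤ (X.filter (· < y)).card :=
    Finset.card_le_card (Finset.monotone_filter_right _ fun a _ (ha : a < x) => ha.trans_le hxy)
  have h2 : (X.filter (· ≤ x)).card ≤ (X.filter (· ≤ y)).card :=
    Finset.card_le_card (Finset.monotone_filter_right _ fun a _ (ha : a ≤ x) => ha.trans hxy)
  unfold gridIndex
  omega

theorem card_filter_le_of_mem (hv : v ∈ X) :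
    (X.filter (· ≤ v)).card = (X.filter (· < v)).card + 1 := by
  rw [← Finset.card_insert_of_notMem (a := v) (s := X.filter (· < v)) (by simp)]
  congr 1
  ext a
  simp only [Finset.mem_filter, Finset.mem_insert, le_iff_lt_or_eq]
  constructor
  · rintro ⟨h1, h2 | h2⟩ <;> tauto
  · rintro (rfl | h) <;> tauto

theorem card_filter_le_of_notMem (hx : x ∉ X) :
    (X.filter (· ≤ x)).card = (X.filter (· < x)).card := by
  congr 1
  refine Finset.filter_congr fun a ha => ?_
  rw [le_iff_lt_or_eq, or_iff_left]
  rintro rfl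
  exact hx ha

theorem odd_gridIndex_iff : Odd (gridIndex X x) ↔ x ∈ X := by
  unfold gridIndex
  by_cases hx : x ∈ X
  · rw [card_filter_le_of_mem hx]
    simp only [hx, iff_true]
    exact ⟨_, by push_cast; ring⟩
  · rw [card_filter_le_of_notMem hx]
    simp [hx]

theorem lt_gridIndex (hv : v ∈ X) (h : x < v) : gridIndex X x < gridIndex X v := by
  have h1 : (X.filter (· < x)).card ≤ (X.filter (· < v)).card :=
    Finset.card_le_card (Finset.monotone_filter_right _ fun a _ (ha : a < x) => ha.trans h)
  have h2 : (X.filter (· ≤ x)).card ≤ (X.filter (· < v)).card :=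
    Finset.card_le_card (Finset.monotone_filter_right _ fun a _ (ha : a ≤ x) => ha.trans_lt h)
  have := card_filter_le_of_mem hv
  unfold gridIndex
  omega

theorem gridIndex_lt (hv : v ∈ X) (h : v < x) : gridIndex X v < gridIndex X x := by
  have h1 : (X.filter (· ≤ v)).card ≤ (X.filter (· < x)).card :=
    Finset.card_le_card (Finset.monotone_filter_right _ fun a _ (ha : a ≤ v) => ha.trans_lt h)
  have h2 : (X.filter (· < x)).card ≤ (X.filter (· ≤ x)).card :=
    Finset.card_le_card (Finset.monotone_filter_right _ fun a _ (ha : a < x) => ha.le)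
  have := card_filter_le_of_mem hv
  unfold gridIndex
  omega

theorem gridIndex_le_iff (hv : v ∈ X) : gridIndex X x ≤ gridIndex X v ↔ x ≤ v :=
  ⟨fun h => not_lt.1 fun hlt => absurd (gridIndex_lt hv hlt) (not_lt.2 h), fun h => gridIndex_mono X h⟩

theorem le_gridIndex_iff (hv : v ∈ X) : gridIndex X v ≤ gridIndex X x ↔ v ≤ x :=
  ⟨fun h => not_lt.1 fun hlt => absurd (lt_gridIndex hv hlt) (not_lt.2 h), fun h => gridIndex_mono X h⟩

theorem gridIndex_eq_iff (hv : v ∈ X) : gridIndex X x = gridIndex X v ↔ x = v := by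
  rw [le_antisymm_iff, gridIndex_le_iff hv, le_gridIndex_iff hv, le_antisymm_iff]

theorem gridIndex_mem_uIcc_iff {a b : ℝ} (ha : a ∈ X) (hb : b ∈ X) :
    gridIndex X x ∈ Set.uIcc (gridIndex X a) (gridIndex X b) ↔ x ∈ Set.uIcc a b := by
  rw [Set.mem_uIcc, Set.mem_uIcc, gridIndex_le_iff ha, gridIndex_le_iff hb, le_gridIndex_iff ha,
    le_gridIndex_iff hb]

theorem gridIndex_mem_uIcc {a b : ℝ} (h : x ∈ Set.uIcc a b) :
    gridIndex X x ∈ Set.uIcc (gridIndex X a) (gridIndex X b) := by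
  rw [Set.mem_uIcc] at *
  exact h.imp (fun h => ⟨gridIndex_mono X h.1, gridIndex_mono X h.2⟩)
    fun h => ⟨gridIndex_mono X h.1, gridIndex_mono X h.2⟩

theorem gridIndex_nonneg (X : Finset ℝ) (x : ℝ) : 0 ≤ gridIndex X x := by
  unfold gridIndex
  omega

theorem gridIndex_le_card (X : Finset ℝ) (x : ℝ) : gridIndex X x ≤ 2 * X.card := by
  have h1 := Finset.card_filter_le X (· < x)
  have h2 := Finset.card_filter_le X (· ≤ x)
  unfold gridIndex
  omega

/-- The gaps of `X`, including the two unbounded ones, are all nonempty; this realizes the even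
indices. -/
theorem exists_card_filter_lt (X : Finset ℝ) (r : ℕ) (hr : r ≤ X.card) :
    ∃ x ∉ X, (X.filter (· < x)).card = r := by
  induction r with
  | zero =>
    obtain ⟨x, hx⟩ := X.finite_toSet.bddBelow
    refine ⟨x - 1, fun h => ?_, ?_⟩
    · have := hx h
      linarith
    · rw [Finset.card_eq_zero, Finset.filter_eq_empty_iff]
      intro a ha
      have := hx ha
      linarith
  | succ r ih =>
    obtain ⟨x, hx, hxr⟩ := ih (by omega)
    have hne : (X.filter (x < ·)).Nonempty := by
      rw [Finset.nonempty_iff_ne_empty]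
      intro hemp
      rw [Finset.filter_eq_empty_iff] at hemp
      have : X.filter (· < x) = X := Finset.filter_true_of_mem fun a ha =>
        lt_of_le_of_ne (not_lt.1 (hemp ha)) (by rintro rfl; exact hx ha)
      rw [this] at hxr
      omega
    obtain ⟨v, hv, hvmin⟩ := (X.filter (x < ·)).exists_min_image id hne
    rw [Finset.mem_filter] at hv
    have hvle : ∀ a ∈ X, x < a → v ≤ a := fun a ha hxa => hvmin a (Finset.mem_filter.2 ⟨ha, hxa⟩)
    have hfil : X.filter (· ≤ v) = insert v (X.filter (· < x)) := by
      ext a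
      simp only [Finset.mem_filter, Finset.mem_insert]
      constructor
      · rintro ⟨h1, h2⟩
        by_cases h : a < x
        · exact .inr ⟨h1, h⟩
        · exact .inl (le_antisymm h2 (hvle a h1
            (lt_of_le_of_ne (not_lt.1 h) (by rintro rfl; exact hx h1))))
      · rintro (rfl | h)
        · exact ⟨hv.1, le_rfl⟩
        · exact ⟨h.1, (h.2.trans hv.2).le⟩
    obtain ⟨y, hvy, hy⟩ : ∃ y, v < y ∧ ∀ a ∈ X, v < a → y < a := by
      by_cases hne' : (X.filter (v < ·)).Nonempty
      · obtain ⟨u, hu, humin⟩ := (X.filter (v < ·)).exists_min_image id hne'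
        rw [Finset.mem_filter] at hu
        obtain ⟨y, hy1, hy2⟩ := exists_between hu.2
        exact ⟨y, hy1, fun a ha hva => hy2.trans_le (humin a (Finset.mem_filter.2 ⟨ha, hva⟩))⟩
      · rw [Finset.not_nonempty_iff_eq_empty, Finset.filter_eq_empty_iff] at hne'
        exact ⟨v + 1, by linarith, fun a ha h => absurd h (hne' ha)⟩
    refine ⟨y, fun h => lt_irrefl _ (hy y h hvy), ?_⟩
    have : X.filter (· < y) = X.filter (· ≤ v) := Finset.filter_congr fun a ha =>
      ⟨fun h => not_lt.1 fun h' => lt_asymm h (hy a ha h'), fun h => h.trans_lt hvy⟩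
    rw [this, hfil, Finset.card_insert_of_notMem, hxr]
    simp only [Finset.mem_filter, not_and, not_lt]
    exact fun _ => hv.2.le

theorem exists_gridIndex_eq (X : Finset ℝ) {i : ℤ} (h0 : 0 ≤ i) (hi : i ≤ 2 * X.card) :
    ∃ x, gridIndex X x = i := by
  lift i to ℕ using h0
  obtain ⟨r, hr⟩ := Nat.even_or_odd' i
  obtain ⟨x, hx, hxr⟩ := exists_card_filter_lt X r (by omega)
  rcases hr with hr | hr
  · exact ⟨x, by unfold gridIndex; rw [card_filter_le_of_notMem hx]; omega⟩
  · obtain ⟨y, hy, hyr⟩ := exists_card_filter_lt X (r + 1) (by omega)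
    obtain ⟨v, hv, hv'⟩ : ∃ v ∈ X.filter (· < y), v ∉ X.filter (· < x) := by
      by_contra! hcon
      have := Finset.card_le_card (show X.filter (· < y) ⊆ X.filter (· < x) from hcon)
      omega
    rw [Finset.mem_filter] at hv hv'
    have hxv : x < v := lt_of_le_of_ne (not_lt.1 fun h => hv' ⟨hv.1, h⟩)
      (by rintro rfl; exact hx hv.1)
    have h1 := lt_gridIndex hv.1 hxv
    have h2 := gridIndex_lt hv.1 hv.2
    refine ⟨v, ?_⟩
    unfold gridIndex at h1 h2 ⊢
    rw [card_filter_le_of_notMem hx] at h1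
    rw [card_filter_le_of_notMem hy] at h2
    omega

theorem exists_mem_uIcc_gridIndex_eq {a b : ℝ} {i : ℤ}
    (hi : i ∈ Set.uIcc (gridIndex X a) (gridIndex X b)) : ∃ x ∈ Set.uIcc a b, gridIndex X x = i := by
  wlog hab : a ≤ b generalizing a b
  · rw [Set.uIcc_comm] at hi ⊢
    exact this hi (not_le.1 hab).le
  rw [Set.uIcc_of_le hab]
  rw [Set.uIcc_of_le (gridIndex_mono X hab)] at hi
  by_cases ha : i = gridIndex X a
  · exact ⟨a, ⟨le_rfl, hab⟩, ha.symm⟩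
  by_cases hb : i = gridIndex X b
  · exact ⟨b, ⟨hab, le_rfl⟩, hb.symm⟩
  obtain ⟨x, rfl⟩ := exists_gridIndex_eq X ((gridIndex_nonneg X a).trans hi.1)
    (hi.2.trans (gridIndex_le_card X b))
  refine ⟨x, ⟨not_lt.1 fun h => ha (le_antisymm (gridIndex_mono X h.le) hi.1),
    not_lt.1 fun h => hb (le_antisymm hi.2 (gridIndex_mono X h.le))⟩, rfl⟩

/-- Near a point in the relative interior of a grid segment, only its own pixel and the two cells
beside it occur. -/
theorem eventually_gridIndex (X : Finset ℝ) (x : ℝ) :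
    ∀ᶠ y in nhds x, gridIndex X x - 1 ≤ gridIndex X y ∧ gridIndex X y ≤ gridIndex X x + 1 ∧
      (x ∉ X → gridIndex X y = gridIndex X x) := by
  have h : ∀ᶠ y in nhds x, ∀ v ∈ X, (v < x → v < y) ∧ (x < v → y < v) := by
    rw [Filter.eventually_all_finset]
    intro v _
    refine Filter.Eventually.and ?_ ?_
    · by_cases hv : v < x
      · filter_upwards [lt_mem_nhds hv] with y hy _ using hy
      · exact Filter.Eventually.of_forall fun y h => absurd h hv
    · by_cases hv : x < v
      · filter_upwards [gt_mem_nhds hv] with y hy _ using hy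
      · exact Filter.Eventually.of_forall fun y h => absurd h hv
  filter_upwards [h] with y hy
  have h1 : (X.filter (· < x)).card ≤ (X.filter (· < y)).card :=
    Finset.card_le_card (Finset.monotone_filter_right _ fun a ha (h : a < x) => (hy a ha).1 h)
  have h2 : (X.filter (· < y)).card ≤ (X.filter (· ≤ y)).card :=
    Finset.card_le_card (Finset.monotone_filter_right _ fun a ha (h : a < y) => h.le)
  have h3 : (X.filter (· ≤ y)).card ≤ (X.filter (· ≤ x)).card :=
    Finset.card_le_card (Finset.monotone_filter_right _ fun a ha (h : a ≤ y) =>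
      not_lt.1 fun hlt => absurd ((hy a ha).2 hlt) (not_lt.2 h))
  unfold gridIndex
  by_cases hx : x ∈ X
  · have := card_filter_le_of_mem hx
    exact ⟨by omega, by omega, fun h => absurd hx h⟩
  · have := card_filter_le_of_notMem hx
    exact ⟨by omega, by omega, fun _ => by omega⟩

theorem isPreconnected_gridIndex (X : Finset ℝ) (i : ℤ) : IsPreconnected {x | gridIndex X x = i} := by
  refine Set.OrdConnected.isPreconnected ⟨fun a ha b hb x hx => ?_⟩
  have h1 := gridIndex_mono X hx.1
  have h2 := gridIndex_mono X hx.2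
  simp only [Set.mem_ofPred_eq] at *
  omega

end gridIndex

/-! ### From polygons to pixel polygons. -/

/-- The pixel of a point in the grid given by `X` and `Y`. -/
noncomputable def gridPixel (X Y : Finset ℝ) (p : ℝ × ℝ) : ℤ × ℤ :=
  (gridIndex X p.1, gridIndex Y p.2)

theorem IsPreconnected.exists_mem_frontier {α : Type*} [TopologicalSpace α] {T P : Set α}
    (hT : IsPreconnected T) {a b : α} (ha : a ∈ T) (hb : b ∈ T) (haP : a ∈ P) (hbP : b ∉ P) :
    ∃ z ∈ T, z ∈ frontier P := by
  by_contra! hcon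
  have hsub : T ⊆ interior P ∪ interior Pᶜ := fun z hz => by
    rw [← compl_frontier_eq_union_interior]
    exact hcon z hz
  obtain ⟨z, -, h1, h2⟩ := hT _ _ isOpen_interior isOpen_interior hsub
    ⟨a, ha, (hsub ha).resolve_right fun h => interior_subset h haP⟩
    ⟨b, hb, (hsub hb).resolve_left fun h => hbP (interior_subset h)⟩
  exact interior_subset h2 (interior_subset h1)

theorem segment_eq_spannedRect {p q : ℝ × ℝ} (h : p.1 = q.1 ∨ p.2 = q.2) :
    segment ℝ p q = spannedRect p q := by
  obtain ⟨p1, p2⟩ := p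
  obtain ⟨q1, q2⟩ := q
  unfold spannedRect
  rcases h with h | h <;> simp only at h <;> subst h
  · rw [← Prod.image_mk_segment_right, segment_eq_uIcc]
    ext ⟨a, b⟩
    simp only [Set.mem_image, Prod.mk.injEq, Set.uIcc_self, Set.mem_prod, Set.mem_singleton_iff]
    constructor
    · rintro ⟨y, hy, rfl, rfl⟩
      exact ⟨rfl, hy⟩
    · rintro ⟨rfl, hb⟩
      exact ⟨b, hb, rfl, rfl⟩
  · rw [← Prod.image_mk_segment_left, segment_eq_uIcc]
    ext ⟨a, b⟩
    simp only [Set.mem_image, Prod.mk.injEq, Set.uIcc_self, Set.mem_prod, Set.mem_singleton_iff]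
    constructor
    · rintro ⟨y, hy, rfl, rfl⟩
      exact ⟨hy, rfl⟩
    · rintro ⟨ha, rfl⟩
      exact ⟨a, ha, rfl, rfl⟩

theorem left_mem_spannedRect (p q : ℝ × ℝ) : p ∈ spannedRect p q := ⟨by simp, by simp⟩

theorem right_mem_spannedRect (p q : ℝ × ℝ) : q ∈ spannedRect p q := ⟨by simp, by simp⟩

/-- A set of points is a union of pixels. -/
def IsGridSaturated (X Y : Finset ℝ) (P : Set (ℝ × ℝ)) : Prop :=
  ∀ p q, gridPixel X Y p = gridPixel X Y q → p ∈ P → q ∈ P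

namespace IsGridSaturated

variable {X Y : Finset ℝ} {P : Set (ℝ × ℝ)}

theorem mem_image_iff (h : IsGridSaturated X Y P) {p : ℝ × ℝ} :
    gridPixel X Y p ∈ gridPixel X Y '' P ↔ p ∈ P :=
  ⟨fun ⟨q, hq, hqp⟩ => h q p hqp hq, Set.mem_image_of_mem _⟩

theorem spannedRect_subset_iff (h : IsGridSaturated X Y P) {p q : ℝ × ℝ} :
    spannedRect p q ⊆ P ↔ PixelRect (gridPixel X Y '' P) (gridPixel X Y p) (gridPixel X Y q) := by
  constructor
  · intro hsub s hs t ht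
    obtain ⟨x, hx, rfl⟩ := exists_mem_uIcc_gridIndex_eq hs
    obtain ⟨y, hy, rfl⟩ := exists_mem_uIcc_gridIndex_eq ht
    exact ⟨(x, y), hsub ⟨hx, hy⟩, rfl⟩
  · rintro hrect z ⟨hz1, hz2⟩
    exact h.mem_image_iff.1 (hrect _ (gridIndex_mem_uIcc hz1) _ (gridIndex_mem_uIcc hz2))

end IsGridSaturated

section polygon

variable {n : ℕ} {P : Set (ℝ × ℝ)} {v : ZMod n → ℝ × ℝ} {X Y : Finset ℝ}

theorem IsSimpleOrthogonalCurve.eq_or_eq (hv : IsSimpleOrthogonalCurve n v) (i : ZMod n) :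
    (v i).1 = (v (i + 1)).1 ∨ (v i).2 = (v (i + 1)).2 := by
  rcases hv.alternating i with ⟨⟨h, -⟩, -⟩ | ⟨⟨h, -⟩, -⟩
  exacts [.inr h, .inl h]

theorem IsSimpleOrthogonalCurve.mem_segment_iff (hv : IsSimpleOrthogonalCurve n v)
    (hX : ∀ i, (v i).1 ∈ X) (hY : ∀ i, (v i).2 ∈ Y) {i : ZMod n} {p : ℝ × ℝ} :
    p ∈ segment ℝ (v i) (v (i + 1)) ↔
      gridPixel X Y p ∈ edgePixels (fun i => gridPixel X Y (v i)) i := by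
  rw [segment_eq_spannedRect (hv.eq_or_eq i)]
  exact and_congr (gridIndex_mem_uIcc_iff (hX _) (hX _)).symm
    (gridIndex_mem_uIcc_iff (hY _) (hY _)).symm

theorem exists_of_mem_edgePixels {i : ZMod n} {c : ℤ × ℤ}
    (hc : c ∈ edgePixels (fun i => gridPixel X Y (v i)) i) : ∃ p, gridPixel X Y p = c := by
  obtain ⟨x, -, hx⟩ := exists_mem_uIcc_gridIndex_eq hc.1
  obtain ⟨y, -, hy⟩ := exists_mem_uIcc_gridIndex_eq hc.2
  exact ⟨(x, y), Prod.ext hx hy⟩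

/-- A pixel is connected as a set of points. If it met `P` and the complement, it would meet the
frontier, hence an edge; but edges are unions of pixels and lie in `P`. -/
theorem isGridSaturated_polygon (hP : IsClosed P) (hv : IsSimpleOrthogonalCurve n v)
    (hfr : frontier P = ⋃ i, segment ℝ (v i) (v (i + 1)))
    (hX : ∀ i, (v i).1 ∈ X) (hY : ∀ i, (v i).2 ∈ Y) : IsGridSaturated X Y P := by
  intro p q hpq hp
  by_contra hq
  have hcon : IsPreconnected ({x | gridIndex X x = gridIndex X p.1} ×ˢ
      {y | gridIndex Y y = gridIndex Y p.2}) :=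
    (isPreconnected_gridIndex X _).prod (isPreconnected_gridIndex Y _)
  obtain ⟨z, hz, hzf⟩ := hcon.exists_mem_frontier (a := p) (b := q) ⟨rfl, rfl⟩
    ⟨(congrArg Prod.fst hpq).symm, (congrArg Prod.snd hpq).symm⟩ hp hq
  rw [hfr, Set.mem_iUnion] at hzf
  obtain ⟨i, hi⟩ := hzf
  rw [hv.mem_segment_iff hX hY, show gridPixel X Y z = gridPixel X Y q from
    (Prod.ext hz.1 hz.2 : gridPixel X Y z = gridPixel X Y p).trans hpq,
    ← hv.mem_segment_iff hX hY] at hi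
  refine hq (hP.frontier_subset ?_)
  rw [hfr]
  exact Set.mem_iUnion_of_mem i hi

/-- The extreme indices belong to unbounded strips. The inequalities are strict so that the
neighbors of a pixel of `P` also contain points. -/
theorem gridPixel_bounds (hP : IsCompact P) (hsat : IsGridSaturated X Y P) {p : ℝ × ℝ}
    (hp : p ∈ P) : (0 < gridIndex X p.1 ∧ gridIndex X p.1 < 2 * X.card) ∧
      0 < gridIndex Y p.2 ∧ gridIndex Y p.2 < 2 * Y.card := by
  obtain ⟨R, hR⟩ := hP.isBounded.exists_norm_le
  have hR' : ∀ q ∈ P, |q.1| ≤ R ∧ |q.2| ≤ R := fun q hq =>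
    ⟨(norm_fst_le q).trans (hR q hq), (norm_snd_le q).trans (hR q hq)⟩
  have h1 : ∀ x, gridIndex X x = gridIndex X p.1 → |x| ≤ R := fun x hx =>
    (hR' (x, p.2) (hsat p _ (Prod.ext hx.symm rfl) hp)).1
  have h2 : ∀ y, gridIndex Y y = gridIndex Y p.2 → |y| ≤ R := fun y hy =>
    (hR' (p.1, y) (hsat p _ (Prod.ext rfl hy.symm) hp)).2
  have key : ∀ (X : Finset ℝ) (x : ℝ), (∀ y, gridIndex X y = gridIndex X x → |y| ≤ R) →
      0 < gridIndex X x ∧ gridIndex X x < 2 * X.card := by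
    intro X x hx
    constructor
    · by_contra hcon
      have h3 := gridIndex_mono X (min_le_left x (-R - 1))
      have h4 := gridIndex_nonneg X (min x (-R - 1))
      have := hx (min x (-R - 1)) (by omega)
      have h5 := min_le_right x (-R - 1)
      linarith [(abs_le.1 this).1]
    · by_contra hcon
      have h3 := gridIndex_mono X (le_max_left x (R + 1))
      have h4 := gridIndex_le_card X (max x (R + 1))
      have := hx (max x (R + 1)) (by omega)
      have h5 := le_max_right x (R + 1)
      linarith [(abs_le.1 this).2]
  exact ⟨key X _ h1, key Y _ h2⟩

theorem exists_mem_edge_of_adj (hP : IsCompact P) (hv : IsSimpleOrthogonalCurve n v)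
    (hfr : frontier P = ⋃ i, segment ℝ (v i) (v (i + 1)))
    (hX : ∀ i, (v i).1 ∈ X) (hY : ∀ i, (v i).2 ∈ Y) {a b : ℤ × ℤ} (ha : a ∈ gridPixel X Y '' P)
    (hb : b ∉ gridPixel X Y '' P) (hab : PixelAdj a b) :
    ∃ i, a ∈ edgePixels (fun i => gridPixel X Y (v i)) i := by
  have hsat := isGridSaturated_polygon hP.isClosed hv hfr hX hY
  have hbd : (0 < a.1 ∧ a.1 < 2 * X.card) ∧ 0 < a.2 ∧ a.2 < 2 * Y.card := by
    obtain ⟨p, hp, rfl⟩ := ha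
    exact gridPixel_bounds hP hsat hp
  have hrange : (0 ≤ b.1 ∧ b.1 ≤ 2 * X.card) ∧ 0 ≤ b.2 ∧ b.2 ≤ 2 * Y.card := by
    unfold PixelAdj at hab
    omega
  obtain ⟨q1, hq1⟩ := exists_gridIndex_eq X hrange.1.1 hrange.1.2
  obtain ⟨q2, hq2⟩ := exists_gridIndex_eq Y hrange.2.1 hrange.2.2
  have hq : gridPixel X Y (q1, q2) = b := Prod.ext hq1 hq2
  obtain ⟨p, hp⟩ : ∃ p, gridPixel X Y p = a := ha.imp fun p hp => hp.2
  set q := (q1, q2)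
  rw [← hp, hsat.mem_image_iff] at ha
  rw [← hq, hsat.mem_image_iff] at hb
  have hcon : IsPreconnected (spannedRect p q) := isPreconnected_uIcc.prod isPreconnected_uIcc
  obtain ⟨z, hz, hzf⟩ := hcon.exists_mem_frontier (left_mem_spannedRect p q)
    (right_mem_spannedRect p q) ha hb
  have hzP := hP.isClosed.frontier_subset hzf
  rw [hfr, Set.mem_iUnion] at hzf
  obtain ⟨i, hi⟩ := hzf
  rw [hv.mem_segment_iff hX hY] at hi
  have hz' : gridPixel X Y z = a ∨ gridPixel X Y z = b := by
    have h1 := gridIndex_mem_uIcc (X := X) hz.1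
    have h2 := gridIndex_mem_uIcc (X := Y) hz.2
    rw [← hp, ← hq] at hab ⊢
    unfold PixelAdj gridPixel at *
    simp only [Set.mem_uIcc, Prod.mk.injEq] at *
    omega
  rcases hz' with hz' | hz'
  · exact ⟨i, hz' ▸ hi⟩
  · exact absurd (hsat z q (hz'.trans hq.symm) hzP) hb

/-- Near a frontier point of a regular closed set there are points of its interior and of its
complement. -/
theorem exists_near_frontier (hcl : closure (interior P) = P) {z : ℝ × ℝ} (hz : z ∈ frontier P)
    {U : Set (ℝ × ℝ)} (hU : U ∈ nhds z) : (∃ p ∈ U, p ∈ interior P) ∧ ∃ p ∈ U, p ∉ P := by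
  constructor
  · have : z ∈ closure (interior P) := by
      have : IsClosed P := hcl ▸ isClosed_closure
      rw [hcl]
      exact this.frontier_subset hz
    obtain ⟨p, hp⟩ := mem_closure_iff_nhds.1 this U hU
    exact ⟨p, hp⟩
  · have : z ∈ closure Pᶜ := by
      rw [frontier_eq_closure_inter_closure] at hz
      exact hz.2
    obtain ⟨p, hp⟩ := mem_closure_iff_nhds.1 this U hU
    exact ⟨p, hp⟩

theorem isPixelPolygon_of_curve (hP : IsCompact P) (hcl : closure (interior P) = P)
    (hv : IsSimpleOrthogonalCurve n v) (hfr : frontier P = ⋃ i, segment ℝ (v i) (v (i + 1)))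
    (hX : ∀ i, (v i).1 ∈ X) (hY : ∀ i, (v i).2 ∈ Y) (hXn : X.card ≤ n) (hYn : Y.card ≤ n) :
    IsPixelPolygon n (2 * n) (gridPixel X Y '' P) (fun i => gridPixel X Y (v i)) := by
  have hsat := isGridSaturated_polygon hP.isClosed hv hfr hX hY
  have hfrP := hP.isClosed.frontier_subset
  have hmem : ∀ {p}, p ∈ frontier P ↔
      ∃ i, gridPixel X Y p ∈ edgePixels (fun i => gridPixel X Y (v i)) i := by
    intro p
    rw [hfr, Set.mem_iUnion]
    exact exists_congr fun i => hv.mem_segment_iff hX hY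
  -- By regular closedness there are interior and exterior points near `z`. Neither kind lies in the
  -- pixel of `z`, which consists of frontier points, so they occupy `a` and `b`, one each.
  have hside : ∀ z ∈ frontier P, ∀ a b : ℤ × ℤ, (∀ᶠ p in nhds z,
      gridPixel X Y p = a ∨ gridPixel X Y p = b ∨ gridPixel X Y p = gridPixel X Y z) →
      (a ∈ gridPixel X Y '' P ↔ b ∉ gridPixel X Y '' P) := by
    intro z hz a b hU
    obtain ⟨⟨p, hpU, hp⟩, ⟨q, hqU, hq⟩⟩ := exists_near_frontier hcl hz hU
    have hpz : gridPixel X Y p ≠ gridPixel X Y z := fun h => by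
      rw [hmem, ← h, ← hmem] at hz
      exact hz.2 hp
    have hqz : gridPixel X Y q ≠ gridPixel X Y z := fun h => hq (hsat z q h.symm (hfrP hz))
    have hp' := hsat.mem_image_iff.2 (interior_subset hp)
    have hq' := mt hsat.mem_image_iff.1 hq
    have hpU := (or_assoc.2 hpU).resolve_right hpz
    have hqU := (or_assoc.2 hqU).resolve_right hqz
    rcases hpU with rfl | rfl <;> rcases hqU with h | h <;> rw [h] at hq' <;> tauto
  refine ⟨?_, ?_, ?_, ?_, ?_, ?_, ?_, ?_⟩
  · rintro _ ⟨p, hp, rfl⟩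
    have h1 := gridPixel_bounds hP hsat hp
    simp only [gridPixel]
    push_cast
    omega
  · exact fun i => ⟨odd_gridIndex_iff.2 (hX i), odd_gridIndex_iff.2 (hY i)⟩
  · intro i
    have h12 : i + 2 = i + 1 + 1 := by ring
    simp only [gridPixel, gridIndex_eq_iff (hX _), gridIndex_eq_iff (hY _), ne_eq]
    rw [← h12]
    exact (hv.alternating i).imp (fun h => ⟨h.1.1, h.1.2, h.2.1, h.2.2⟩)
      fun h => ⟨h.1.1, h.1.2, h.2.1, h.2.2⟩
  · intro i j h1 h2 h3
    rw [Set.disjoint_left]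
    intro c hci hcj
    obtain ⟨p, rfl⟩ := exists_of_mem_edgePixels hci
    rw [← hv.mem_segment_iff hX hY] at hci hcj
    exact Set.disjoint_left.1 (hv.disjoint i j h1 h2 h3) hci hcj
  · intro i c hc
    obtain ⟨p, rfl⟩ := exists_of_mem_edgePixels hc
    exact ⟨p, hfrP (hmem.2 ⟨i, hc⟩), rfl⟩
  · exact fun a ha b hb hab => exists_mem_edge_of_adj hP hv hfr hX hY ha hb hab
  · rintro x y hx ⟨i, hi⟩
    obtain ⟨z, hz⟩ := exists_of_mem_edgePixels hi
    have hzf : z ∈ frontier P := hmem.2 ⟨i, hz ▸ hi⟩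
    obtain ⟨rfl, rfl⟩ := Prod.ext_iff.1 hz
    refine hside z hzf _ _ ?_
    have hzX : z.1 ∉ X := fun h => Int.not_even_iff_odd.2 (odd_gridIndex_iff.2 h) hx
    filter_upwards [continuousAt_fst.eventually (eventually_gridIndex X z.1),
      continuousAt_snd.eventually (eventually_gridIndex Y z.2)] with p hp1 hp2
    have := hp1.2.2 hzX
    simp only [gridPixel, Prod.mk.injEq]
    omega
  · rintro x y hy ⟨i, hi⟩
    obtain ⟨z, hz⟩ := exists_of_mem_edgePixels hi
    have hzf : z ∈ frontier P := hmem.2 ⟨i, hz ▸ hi⟩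
    obtain ⟨rfl, rfl⟩ := Prod.ext_iff.1 hz
    refine hside z hzf _ _ ?_
    have hzY : z.2 ∉ Y := fun h => Int.not_even_iff_odd.2 (odd_gridIndex_iff.2 h) hy
    filter_upwards [continuousAt_fst.eventually (eventually_gridIndex X z.1),
      continuousAt_snd.eventually (eventually_gridIndex Y z.2)] with p hp1 hp2
    have := hp2.2.2 hzY
    simp only [gridPixel, Prod.mk.injEq]
    omega

/-- A simple orthogonal polygon with `n` vertices has a strong chromatic r-guarding with
logarithmically many colors. -/
theorem IsSimpleOrthogonalPolygon.hasStrongChromaticRGuarding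
    (h : IsSimpleOrthogonalPolygon P n) :
    HasStrongChromaticRGuarding P (6 * (Nat.log 2 (2 * n + 1) + 1) + 1) := by
  classical
  obtain ⟨hP, hcl, v, hv, hfr⟩ := h
  have hn : n ≠ 0 := by
    have := hv.four_le
    omega
  have : NeZero n := ⟨hn⟩
  set X : Finset ℝ := Finset.univ.image fun i => (v i).1
  set Y : Finset ℝ := Finset.univ.image fun i => (v i).2
  have hX : ∀ i, (v i).1 ∈ X := fun i => Finset.mem_image_of_mem _ (Finset.mem_univ i)
  have hY : ∀ i, (v i).2 ∈ Y := fun i => Finset.mem_image_of_mem _ (Finset.mem_univ i)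
  have hXn : X.card ≤ n := Finset.card_image_le.trans (by simp [ZMod.card])
  have hYn : Y.card ≤ n := Finset.card_image_le.trans (by simp [ZMod.card])
  have hsat := isGridSaturated_polygon hP.isClosed hv hfr hX hY
  have hpix := isPixelPolygon_of_curve hP hcl hv hfr hX hY hXn hYn
  have hne : (gridPixel X Y '' P).Nonempty :=
    ⟨_, hpix.edge_subset 0 (IsPixelPolygon.vertex_mem 0)⟩
  obtain ⟨G, γ, hG, hcov, hcol⟩ := exists_pixel_guarding hpix.bounds hne (hpix.connected hn)
    (hpix.compl_connected hn)
  -- Any point of a guard pixel can serve as the guard.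
  choose! ρ hρP hρ using hG
  refine ⟨G.image ρ, fun g => γ (gridPixel X Y g), ⟨?_, ?_⟩, ?_⟩
  · intro p hp
    obtain ⟨g, hg, rfl⟩ := Finset.mem_image.1 (Finset.mem_coe.1 hp)
    exact hρP g hg
  · refine Set.Subset.antisymm (Set.iUnion₂_subset fun g _ => Set.sep_subset _ _) fun q hq => ?_
    obtain ⟨g, hg, hgq⟩ := hcov _ (Set.mem_image_of_mem _ hq)
    refine Set.mem_iUnion₂.2 ⟨ρ g, Finset.mem_image_of_mem ρ hg, hq, ?_⟩
    rwa [hsat.spannedRect_subset_iff, hρ g hg]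
  · rintro ⟨a, ha⟩ ⟨a', ha'⟩ hne ⟨q, hq, hq'⟩ hγ
    obtain ⟨g, hg, rfl⟩ := Finset.mem_image.1 ha
    obtain ⟨g', hg', rfl⟩ := Finset.mem_image.1 ha'
    have h1 := hsat.spannedRect_subset_iff.1 hq.2
    have h2 := hsat.spannedRect_subset_iff.1 hq'.2
    simp only [hρ g hg, hρ g' hg'] at h1 h2 hγ
    exact hne (Subtype.ext (congrArg ρ (hcol g hg g' hg' _ h1 h2 hγ)))

end polygon

/-! ### Histograms as simple orthogonal polygons. -/

/-- The union of the columns `[j, j + 1] × [f j, T]`, for `j < m`. -/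
def columnRegion (m : ℕ) (f : ℕ → ℝ) (T : ℝ) : Set (ℝ × ℝ) :=
  ⋃ j ∈ Finset.range m, Set.Icc (j : ℝ) (j + 1) ×ˢ Set.Icc (f j) T

/-- The vertices of `columnRegion m f T`, the first of them occurring twice. -/
noncomputable def columnVertex (m : ℕ) (f : ℕ → ℝ) (T : ℝ) (k : ℕ) : ℝ × ℝ :=
  if k < 2 * m then (((k / 2 + k % 2 : ℕ) : ℝ), f (k / 2))
  else if k = 2 * m then (m, T) else if k = 2 * m + 1 then (0, T) else (0, f 0)

section columnRegion

variable {m : ℕ} {f : ℕ → ℝ} {T : ℝ}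

theorem mem_columnRegion {p : ℝ × ℝ} : p ∈ columnRegion m f T ↔
    ∃ j < m, ((j : ℝ) ≤ p.1 ∧ p.1 ≤ j + 1) ∧ f j ≤ p.2 ∧ p.2 ≤ T := by
  simp only [columnRegion, Set.mem_iUnion, Finset.mem_range, Set.mem_prod, Set.mem_Icc, exists_prop]

theorem columnVertex_even {j : ℕ} (hj : j < m) : columnVertex m f T (2 * j) = ((j : ℝ), f j) := by
  rw [columnVertex, if_pos (by omega), show 2 * j / 2 = j by omega, show 2 * j % 2 = 0 by omega,
    add_zero]

theorem columnVertex_odd {j : ℕ} (hj : j < m) :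
    columnVertex m f T (2 * j + 1) = (((j + 1 : ℕ) : ℝ), f j) := by
  rw [columnVertex, if_pos (by omega), show (2 * j + 1) / 2 = j by omega,
    show (2 * j + 1) % 2 = 1 by omega]

theorem columnVertex_two_mul : columnVertex m f T (2 * m) = ((m : ℝ), T) := by
  simp [columnVertex]

theorem columnVertex_two_mul_add_one : columnVertex m f T (2 * m + 1) = (0, T) := by
  simp [columnVertex]

theorem columnVertex_two_mul_add_two : columnVertex m f T (2 * m + 2) = (0, f 0) := by
  simp [columnVertex]

/-- The edge number `k` of `columnRegion m f T`. -/
def columnEdge (m : ℕ) (f : ℕ → ℝ) (T : ℝ) (k : ℕ) : Set (ℝ × ℝ) :=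
  segment ℝ (columnVertex m f T k) (columnVertex m f T (k + 1))

theorem mem_columnEdge_floor {j : ℕ} (hj : j < m) {p : ℝ × ℝ} :
    p ∈ columnEdge m f T (2 * j) ↔ ((j : ℝ) ≤ p.1 ∧ p.1 ≤ j + 1) ∧ p.2 = f j := by
  rw [columnEdge, columnVertex_even hj, columnVertex_odd hj, segment_eq_spannedRect]
  · simp [spannedRect, Set.mem_prod]
  · simp

theorem mem_columnEdge_wall {j : ℕ} (hj : j + 1 < m) {p : ℝ × ℝ} :
    p ∈ columnEdge m f T (2 * j + 1) ↔ p.1 = (j + 1 : ℕ) ∧ p.2 ∈ Set.uIcc (f j) (f (j + 1)) := by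
  rw [columnEdge, columnVertex_odd (by omega), show 2 * j + 1 + 1 = 2 * (j + 1) by ring,
    columnVertex_even hj, segment_eq_spannedRect]
  · simp [spannedRect, Set.mem_prod]
  · simp

theorem mem_columnEdge_right {j : ℕ} (hj : j + 1 = m) (hT : f j < T) {p : ℝ × ℝ} :
    p ∈ columnEdge m f T (2 * j + 1) ↔ p.1 = (j + 1 : ℕ) ∧ f j ≤ p.2 ∧ p.2 ≤ T := by
  rw [columnEdge, columnVertex_odd (by omega), show 2 * j + 1 + 1 = 2 * m by omega,
    columnVertex_two_mul, segment_eq_spannedRect]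
  · simp [spannedRect, Set.mem_prod, Set.uIcc_of_le hT.le, ← hj]
  · simp [← hj]

theorem mem_columnEdge_top {p : ℝ × ℝ} :
    p ∈ columnEdge m f T (2 * m) ↔ (0 ≤ p.1 ∧ p.1 ≤ m) ∧ p.2 = T := by
  rw [columnEdge, columnVertex_two_mul, columnVertex_two_mul_add_one,
    segment_eq_spannedRect]
  · simp [spannedRect, Set.mem_prod]
  · simp

theorem mem_columnEdge_left (hT : f 0 < T) {p : ℝ × ℝ} :
    p ∈ columnEdge m f T (2 * m + 1) ↔ p.1 = 0 ∧ f 0 ≤ p.2 ∧ p.2 ≤ T := by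
  rw [columnEdge, columnVertex_two_mul_add_one, columnVertex_two_mul_add_two,
    segment_eq_spannedRect]
  · simp [spannedRect, Set.mem_prod, Set.uIcc_of_ge hT.le]
  · simp

theorem exists_edge_index {k : ℕ} (hk : k < 2 * m + 2) :
    (∃ j < m, k = 2 * j) ∨ (∃ j, j + 1 < m ∧ k = 2 * j + 1) ∨ (∃ j, j + 1 = m ∧ k = 2 * j + 1) ∨
      k = 2 * m ∨ k = 2 * m + 1 := by
  rcases Nat.even_or_odd' k with ⟨j, h | h⟩
  · by_cases hj : j < m
    · exact .inl ⟨j, hj, h⟩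
    · omega
  · by_cases hj : j + 1 < m
    · exact .inr (.inl ⟨j, hj, h⟩)
    · by_cases hj : j + 1 = m
      · exact .inr (.inr (.inl ⟨j, hj, h⟩))
      · omega

theorem isHorizontalEdge_columnVertex (hm : 1 ≤ m) {k : ℕ} (hk : k < 2 * m + 2) (he : Even k) :
    IsHorizontalEdge (columnVertex m f T k) (columnVertex m f T (k + 1)) := by
  obtain ⟨r, hr⟩ := he
  rcases exists_edge_index hk with ⟨j, hj, rfl⟩ | ⟨j, -, h⟩ | ⟨j, -, h⟩ | rfl | h
  · rw [columnVertex_even hj, columnVertex_odd hj]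
    exact ⟨rfl, by simp⟩
  · omega
  · omega
  · rw [columnVertex_two_mul, columnVertex_two_mul_add_one]
    exact ⟨rfl, by simp only [ne_eq, Nat.cast_eq_zero]; omega⟩
  · omega

theorem isVerticalEdge_columnVertex (hm : 1 ≤ m) (hT : ∀ j < m, f j < T)
    (hf : ∀ j, j + 1 < m → f j ≠ f (j + 1)) {k : ℕ} (hk : k < 2 * m + 2) (ho : Odd k) :
    IsVerticalEdge (columnVertex m f T k) (columnVertex m f T (k + 1)) := by
  obtain ⟨r, hr⟩ := ho
  rcases exists_edge_index hk with ⟨j, hj, rfl⟩ | ⟨j, hj, rfl⟩ | ⟨j, hj, rfl⟩ | rfl | rfl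
  · omega
  · rw [columnVertex_odd (by omega), show 2 * j + 1 + 1 = 2 * (j + 1) by ring, columnVertex_even hj]
    exact ⟨rfl, hf j hj⟩
  · rw [columnVertex_odd (by omega), show 2 * j + 1 + 1 = 2 * m by omega, columnVertex_two_mul]
    exact ⟨by simp [hj], (hT j (by omega)).ne⟩
  · omega
  · rw [columnVertex_two_mul_add_one, columnVertex_two_mul_add_two]
    exact ⟨rfl, (hT 0 (by omega)).ne'⟩

/-- The hypothesis `hne` excludes the first and the last edge, which are consecutive in the cyclic
order. -/
theorem disjoint_columnEdge (hm : 1 ≤ m) (hT : ∀ j < m, f j < T)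
    (hf : ∀ j, j + 1 < m → f j ≠ f (j + 1)) {k l : ℕ} (hkl : k + 1 < l) (hl : l < 2 * m + 2)
    (hne : k ≠ 0 ∨ l ≠ 2 * m + 1) : Disjoint (columnEdge m f T k) (columnEdge m f T l) := by
  rw [Set.disjoint_left]
  intro p hp hq
  rcases exists_edge_index hl with ⟨j', hj', rfl⟩ | ⟨j', hj', rfl⟩ | ⟨j', hj', rfl⟩ | rfl | rfl <;>
  rcases exists_edge_index (by omega : k < 2 * m + 2) with
    ⟨j, hj, rfl⟩ | ⟨j, hj, rfl⟩ | ⟨j, hj, rfl⟩ | rfl | rfl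
  all_goals try omega
  all_goals first
    | rw [mem_columnEdge_floor hj] at hp
    | rw [mem_columnEdge_wall hj] at hp
    | rw [mem_columnEdge_right hj (hT _ (by omega))] at hp
  all_goals first
    | rw [mem_columnEdge_floor hj'] at hq
    | rw [mem_columnEdge_wall hj'] at hq
    | rw [mem_columnEdge_right hj' (hT _ (by omega))] at hq
    | rw [mem_columnEdge_top] at hq
    | rw [mem_columnEdge_left (hT _ (by omega))] at hq
  · have h1 : (j' : ℝ) ≤ j + 1 := hq.1.1.trans hp.1.2
    have h1 : j' ≤ j + 1 := by exact_mod_cast h1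
    obtain rfl : j' = j + 1 := by omega
    exact hf j hj' (hp.2.symm.trans hq.2)
  · have h1 : (j' : ℝ) ≤ (j + 1 : ℕ) := hp.1 ▸ hq.1.1
    have h1 : j' ≤ j + 1 := by exact_mod_cast h1
    omega
  · have h1 : ((j' + 1 : ℕ) : ℝ) ≤ j + 1 := hq.1 ▸ hp.1.2
    have h1 : j' + 1 ≤ j + 1 := by exact_mod_cast h1
    omega
  · have h1 : j + 1 = j' + 1 := by exact_mod_cast hp.1.symm.trans hq.1
    omega
  · have h1 : ((j' + 1 : ℕ) : ℝ) ≤ j + 1 := hq.1 ▸ hp.1.2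
    have h1 : j' + 1 ≤ j + 1 := by exact_mod_cast h1
    omega
  · have h1 : j + 1 = j' + 1 := by exact_mod_cast hp.1.symm.trans hq.1
    omega
  · exact (hT j hj).ne (hp.2.symm.trans hq.2)
  · have h1 := hp.2
    rw [hq.2, Set.mem_uIcc] at h1
    have h2 := hT j (by omega)
    have h3 := hT (j + 1) hj
    rcases h1 with h1 | h1 <;> linarith [h1.2]
  · have h1 : (j : ℝ) ≤ 0 := hq.1 ▸ hp.1.1
    have h1 : j ≤ 0 := by exact_mod_cast h1
    omega
  · have h1 : j + 1 = 0 := by exact_mod_cast hp.1.symm.trans hq.1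
    omega
  · have h1 : j + 1 = 0 := by exact_mod_cast hp.1.symm.trans hq.1
    omega

theorem isClosed_columnRegion : IsClosed (columnRegion m f T) :=
  Set.Finite.isClosed_biUnion (Finset.finite_toSet _) fun _ _ => isClosed_Icc.prod isClosed_Icc

theorem isCompact_columnRegion : IsCompact (columnRegion m f T) :=
  Finset.isCompact_biUnion _ fun _ _ => isCompact_Icc.prod isCompact_Icc

theorem closure_interior_columnRegion (hT : ∀ j < m, f j < T) :
    closure (interior (columnRegion m f T)) = columnRegion m f T := by
  refine Set.Subset.antisymm (closure_minimal interior_subset isClosed_columnRegion) fun p hp => ?_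
  obtain ⟨j, hj, h1, h2⟩ := mem_columnRegion.1 hp
  have hsub : Set.Ioo (j : ℝ) (j + 1) ×ˢ Set.Ioo (f j) T ⊆ interior (columnRegion m f T) :=
    interior_maximal (fun q hq => mem_columnRegion.2
      ⟨j, hj, ⟨hq.1.1.le, hq.1.2.le⟩, hq.2.1.le, hq.2.2.le⟩) (isOpen_Ioo.prod isOpen_Ioo)
  refine closure_mono hsub ?_
  rw [closure_prod_eq, closure_Ioo (by simp), closure_Ioo (hT j hj).ne]
  exact ⟨h1, h2⟩

theorem floor_le_of_mem_columnRegion {p : ℝ × ℝ} (hp : p ∈ columnRegion m f T) {j : ℕ}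
    (h1 : (j : ℝ) < p.1) (h2 : p.1 < j + 1) : j < m ∧ f j ≤ p.2 := by
  obtain ⟨i, hi, h3, h4⟩ := mem_columnRegion.1 hp
  have h5 : (i : ℝ) < j + 1 := h3.1.trans_lt h2
  have h6 : (j : ℝ) < i + 1 := h1.trans_le h3.2
  have h5 : i < j + 1 := by exact_mod_cast h5
  have h6 : j < i + 1 := by exact_mod_cast h6
  obtain rfl : i = j := by omega
  exact ⟨hi, h4.1⟩

theorem bounds_of_mem_columnRegion {p : ℝ × ℝ} (hp : p ∈ columnRegion m f T) :
    (0 ≤ p.1 ∧ p.1 ≤ m) ∧ p.2 ≤ T := by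
  obtain ⟨i, hi, h3, h4⟩ := mem_columnRegion.1 hp
  have h5 : ((i + 1 : ℕ) : ℝ) ≤ m := by exact_mod_cast hi
  push_cast at h5
  exact ⟨⟨(Nat.cast_nonneg i).trans h3.1, h3.2.trans h5⟩, h4.2⟩

theorem mem_interior_of_inner_wall {j : ℕ} (hj : j + 1 < m) {p : ℝ × ℝ}
    (hp : p.1 = (j + 1 : ℕ)) (h1 : f j < p.2) (h2 : f (j + 1) < p.2) (h3 : p.2 < T) :
    p ∈ interior (columnRegion m f T) := by
  have hsub : Set.Ioo (j : ℝ) (j + 2) ×ˢ Set.Ioo (max (f j) (f (j + 1))) T ⊆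
      interior (columnRegion m f T) := by
    refine interior_maximal (fun q hq => mem_columnRegion.2 ?_) (isOpen_Ioo.prod isOpen_Ioo)
    have h4 := max_lt_iff.1 hq.2.1
    rcases le_total q.1 (j + 1) with h | h
    · exact ⟨j, by omega, ⟨hq.1.1.le, h⟩, h4.1.le, hq.2.2.le⟩
    · exact ⟨j + 1, hj, ⟨by push_cast; exact h, by push_cast; linarith [hq.1.2]⟩, h4.2.le,
        hq.2.2.le⟩
  refine hsub ⟨?_, max_lt h1 h2, h3⟩
  rw [hp]
  push_cast
  constructor <;> linarith

theorem frontier_columnRegion (hm : 1 ≤ m) (hT : ∀ j < m, f j < T) :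
    frontier (columnRegion m f T) = {p | ∃ k < 2 * m + 2, p ∈ columnEdge m f T k} := by
  have hfloor : ∀ j < m, Set.Icc (j : ℝ) (j + 1) ×ˢ Set.Iic (f j) ⊆ closure (columnRegion m f T)ᶜ := by
    intro j hj
    have hsub : Set.Ioo (j : ℝ) (j + 1) ×ˢ Set.Iio (f j) ⊆ (columnRegion m f T)ᶜ := fun q hq hqP =>
      absurd (floor_le_of_mem_columnRegion hqP hq.1.1 hq.1.2).2 (not_le.2 hq.2)
    have := closure_mono hsub
    rwa [closure_prod_eq, closure_Ioo (by simp), closure_Iio] at this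
  have hleft : Set.Iic (0 : ℝ) ×ˢ (Set.univ : Set ℝ) ⊆ closure (columnRegion m f T)ᶜ := by
    have hsub : Set.Iio (0 : ℝ) ×ˢ (Set.univ : Set ℝ) ⊆ (columnRegion m f T)ᶜ := fun q hq hqP =>
      absurd (bounds_of_mem_columnRegion hqP).1.1 (not_le.2 hq.1)
    have := closure_mono hsub
    rwa [closure_prod_eq, closure_Iio, closure_univ] at this
  have hright : Set.Ici (m : ℝ) ×ˢ (Set.univ : Set ℝ) ⊆ closure (columnRegion m f T)ᶜ := by
    have hsub : Set.Ioi (m : ℝ) ×ˢ (Set.univ : Set ℝ) ⊆ (columnRegion m f T)ᶜ := fun q hq hqP =>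
      absurd (bounds_of_mem_columnRegion hqP).1.2 (not_le.2 hq.1)
    have := closure_mono hsub
    rwa [closure_prod_eq, closure_Ioi, closure_univ] at this
  have htop : (Set.univ : Set ℝ) ×ˢ Set.Ici T ⊆ closure (columnRegion m f T)ᶜ := by
    have hsub : (Set.univ : Set ℝ) ×ˢ Set.Ioi T ⊆ (columnRegion m f T)ᶜ := fun q hq hqP =>
      absurd (bounds_of_mem_columnRegion hqP).2 (not_le.2 hq.2)
    have := closure_mono hsub
    rwa [closure_prod_eq, closure_Ioi, closure_univ] at this
  apply Set.Subset.antisymm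
  · intro p hp
    rw [isClosed_columnRegion.frontier_eq] at hp
    obtain ⟨hpP, hpi⟩ := hp
    obtain ⟨j, hj, h1, h2⟩ := mem_columnRegion.1 hpP
    have hb := bounds_of_mem_columnRegion hpP
    by_cases hpT : p.2 = T
    · exact ⟨2 * m, by omega, mem_columnEdge_top.2 ⟨hb.1, hpT⟩⟩
    by_cases hpf : p.2 = f j
    · exact ⟨2 * j, by omega, (mem_columnEdge_floor hj).2 ⟨h1, hpf⟩⟩
    have hlt : f j < p.2 := lt_of_le_of_ne h2.1 (Ne.symm hpf)
    have hlt' : p.2 < T := lt_of_le_of_ne h2.2 hpT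
    by_cases hl : p.1 = j
    · rcases Nat.eq_zero_or_pos j with rfl | hj0
      · exact ⟨2 * m + 1, by omega, (mem_columnEdge_left (hT 0 hj)).2 ⟨by simpa using hl, h2⟩⟩
      · obtain ⟨i, rfl⟩ := Nat.exists_eq_succ_of_ne_zero hj0.ne'
        by_cases hi : p.2 ≤ f i
        · exact ⟨2 * i + 1, by omega, (mem_columnEdge_wall hj).2
            ⟨hl, Set.mem_uIcc.2 (.inr ⟨hlt.le, hi⟩)⟩⟩
        · exact absurd (mem_interior_of_inner_wall hj hl (not_le.1 hi) hlt hlt') hpi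
    by_cases hr : p.1 = j + 1
    · rcases (Nat.succ_le_of_lt hj).lt_or_eq with hj1 | hj1
      · by_cases hi : p.2 ≤ f (j + 1)
        · exact ⟨2 * j + 1, by omega, (mem_columnEdge_wall hj1).2
            ⟨by push_cast; exact hr, Set.mem_uIcc.2 (.inl ⟨hlt.le, hi⟩)⟩⟩
        · exact absurd (mem_interior_of_inner_wall hj1 (by push_cast; exact hr) hlt
            (not_le.1 hi) hlt') hpi
      · exact ⟨2 * j + 1, by omega, (mem_columnEdge_right hj1 (hT j hj)).2
          ⟨by push_cast; exact hr, h2⟩⟩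
    · have hsub : Set.Ioo (j : ℝ) (j + 1) ×ˢ Set.Ioo (f j) T ⊆ interior (columnRegion m f T) :=
        interior_maximal (fun q hq => mem_columnRegion.2
          ⟨j, hj, ⟨hq.1.1.le, hq.1.2.le⟩, hq.2.1.le, hq.2.2.le⟩) (isOpen_Ioo.prod isOpen_Ioo)
      exact absurd (hsub ⟨⟨lt_of_le_of_ne h1.1 (Ne.symm hl), lt_of_le_of_ne h1.2 hr⟩, hlt, hlt'⟩) hpi
  · rintro p ⟨k, hk, hp⟩
    rw [frontier_eq_closure_inter_closure, isClosed_columnRegion.closure_eq]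
    rcases exists_edge_index hk with ⟨j, hj, rfl⟩ | ⟨j, hj, rfl⟩ | ⟨j, hj, rfl⟩ | rfl | rfl
    · rw [mem_columnEdge_floor hj] at hp
      exact ⟨mem_columnRegion.2 ⟨j, hj, hp.1, hp.2.ge, hp.2.le.trans (hT j hj).le⟩,
        hfloor j hj ⟨hp.1, hp.2.le⟩⟩
    · rw [mem_columnEdge_wall hj, Set.mem_uIcc] at hp
      have h1 : (j : ℝ) ≤ p.1 ∧ p.1 ≤ j + 1 := by
        rw [hp.1]
        push_cast
        constructor <;> linarith
      have h2 : ((j + 1 : ℕ) : ℝ) ≤ p.1 ∧ p.1 ≤ (j + 1 : ℕ) + 1 := by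
        rw [hp.1]
        constructor <;> linarith
      rcases hp.2 with h | h
      · exact ⟨mem_columnRegion.2 ⟨j, by omega, h1, h.1, h.2.trans (hT _ hj).le⟩,
          hfloor (j + 1) hj ⟨h2, h.2⟩⟩
      · exact ⟨mem_columnRegion.2 ⟨j + 1, hj, h2, h.1, h.2.trans (hT _ (by omega)).le⟩,
          hfloor j (by omega) ⟨h1, h.2⟩⟩
    · rw [mem_columnEdge_right hj (hT j (by omega))] at hp
      refine ⟨mem_columnRegion.2 ⟨j, by omega, ?_, hp.2⟩, hright ⟨?_, trivial⟩⟩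
      · rw [hp.1]
        push_cast
        constructor <;> linarith
      · rw [hp.1, hj]
        exact Set.mem_Ici.2 le_rfl
    · rw [mem_columnEdge_top] at hp
      refine ⟨mem_columnRegion.2 ?_, htop ⟨trivial, hp.2.ge⟩⟩
      rcases hp.1.2.lt_or_eq with h | h
      · refine ⟨⌊p.1⌋₊, (Nat.floor_lt hp.1.1).2 h, ⟨Nat.floor_le hp.1.1, (Nat.lt_floor_add_one _).le⟩,
          ?_, hp.2.le⟩
        rw [hp.2]
        exact (hT _ ((Nat.floor_lt hp.1.1).2 h)).le
      · obtain ⟨i, rfl⟩ := Nat.exists_eq_succ_of_ne_zero (by omega : m ≠ 0)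
        refine ⟨i, by omega, ?_, ?_, hp.2.le⟩
        · rw [h]
          push_cast
          constructor <;> linarith
        · rw [hp.2]
          exact (hT _ (by omega)).le
    · rw [mem_columnEdge_left (hT 0 (by omega))] at hp
      refine ⟨mem_columnRegion.2 ⟨0, by omega, ?_, hp.2⟩, hleft ⟨hp.1.le, trivial⟩⟩
      rw [hp.1]
      simp

/-- `columnRegion m f T` is a simple orthogonal polygon. -/
theorem isSimpleOrthogonalPolygon_columnRegion (hm : 1 ≤ m) (hT : ∀ j < m, f j < T)
    (hf : ∀ j, j + 1 < m → f j ≠ f (j + 1)) :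
    IsSimpleOrthogonalPolygon (columnRegion m f T) (2 * m + 2) := by
  refine ⟨isCompact_columnRegion, closure_interior_columnRegion hT,
    fun i => columnVertex m f T i.val, ?_, ?_⟩
  all_goals
    have hval : ∀ i : ZMod (2 * m + 2), i.val < 2 * m + 2 := ZMod.val_lt
    have hsucc : ∀ i : ZMod (2 * m + 2), (i + 1).val = if i.val + 1 = 2 * m + 2 then 0 else i.val + 1 := by
      intro i
      have : Fact (1 < 2 * m + 2) := ⟨by omega⟩
      rw [ZMod.val_add, ZMod.val_one]
      split_ifs with h
      · rw [h, Nat.mod_self]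
      · exact Nat.mod_eq_of_lt (by have := hval i; omega)
    -- The repeated first vertex absorbs the wrap-around of the cyclic index.
    have hvert : ∀ i : ZMod (2 * m + 2),
        columnVertex m f T (i + 1).val = columnVertex m f T (i.val + 1) := by
      intro i
      rw [hsucc]
      split_ifs with h
      · rw [h, columnVertex_two_mul_add_two, ← mul_zero 2, columnVertex_even (by omega)]
        simp
      · rfl
  · refine ⟨by omega, fun i => ?_, fun i j h1 h2 h3 => ?_⟩
    · have h12 : i + 2 = i + 1 + 1 := by ring
      rw [h12, hvert (i + 1), hvert i]
      rcases Nat.even_or_odd i.val with he | ho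
      · refine .inl ⟨isHorizontalEdge_columnVertex hm (hval i) he, ?_⟩
        rw [← hvert i]
        refine isVerticalEdge_columnVertex hm hT hf (hval (i + 1)) ?_
        obtain ⟨r, hr⟩ := he
        have := hval i
        rw [hsucc, if_neg (by omega)]
        exact ⟨r, by omega⟩
      · refine .inr ⟨isVerticalEdge_columnVertex hm hT hf (hval i) ho, ?_⟩
        rw [← hvert i]
        refine isHorizontalEdge_columnVertex hm (hval (i + 1)) ?_
        obtain ⟨r, hr⟩ := ho
        rw [hsucc]
        split_ifs
        · simp
        · exact ⟨r + 1, by omega⟩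
    · rw [hvert i, hvert j]
      have e1 : i.val ≠ j.val := fun h => h1 (ZMod.val_injective _ h)
      have e2 : j.val ≠ (i + 1).val := fun h => h2 (ZMod.val_injective _ h)
      have e3 : i.val ≠ (j + 1).val := fun h => h3 (ZMod.val_injective _ h)
      have b1 := hval i
      have b2 := hval j
      rw [hsucc] at e2 e3
      rcases lt_or_gt_of_ne e1 with h | h
      · refine disjoint_columnEdge hm hT hf ?_ b2 ?_ <;> split_ifs at e2 e3 <;> omega
      · refine Disjoint.symm (disjoint_columnEdge (k := j.val) hm hT hf ?_ b1 ?_) <;> split_ifs at e2 e3 <;> omega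
  · rw [frontier_columnRegion hm hT]
    ext p
    simp only [Set.mem_ofPred_eq, Set.mem_iUnion]
    constructor
    · rintro ⟨k, hk, hp⟩
      refine ⟨(k : ZMod (2 * m + 2)), ?_⟩
      rw [hvert, ZMod.val_natCast_of_lt hk]
      exact hp
    · rintro ⟨i, hi⟩
      rw [hvert] at hi
      exact ⟨i.val, hval i, hi⟩

end columnRegion

/-! ### The ruler histogram and the lower bound. -/

/-- The histogram with `m` columns whose floors form the ruler sequence. -/
def rulerHistogram (m : ℕ) : Set (ℝ × ℝ) := columnRegion m (fun j => (padicValNat 2 (j + 1) : ℝ)) m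

theorem padicValNat_two_lt {j m : ℕ} (hj : j < m) : padicValNat 2 (j + 1) < m := by
  have h1 := padicValNat_le_nat_log (p := 2) (j + 1)
  have h2 := Nat.log_lt_self 2 (by omega : j + 1 ≠ 0)
  omega

theorem isSimpleOrthogonalPolygon_rulerHistogram {m : ℕ} (hm : 1 ≤ m) :
    IsSimpleOrthogonalPolygon (rulerHistogram m) (2 * m + 2) := by
  refine isSimpleOrthogonalPolygon_columnRegion hm (fun j hj => ?_) (fun j _ h => ?_)
  · exact_mod_cast padicValNat_two_lt hj
  · have h : padicValNat 2 (j + 1) = padicValNat 2 (j + 1 + 1) := by exact_mod_cast h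
    rcases Nat.even_or_odd' j with ⟨k, hk | hk⟩
    · have h1 : padicValNat 2 (j + 1) = 0 := padicValNat.eq_zero_of_not_dvd (by omega)
      have h2 : 1 ≤ padicValNat 2 (j + 1 + 1) := one_le_padicValNat_of_dvd (by omega) (by omega)
      omega
    · have h1 : padicValNat 2 (j + 1 + 1) = 0 := padicValNat.eq_zero_of_not_dvd (by omega)
      have h2 : 1 ≤ padicValNat 2 (j + 1) := one_le_padicValNat_of_dvd (by omega) (by omega)
      omega

theorem padicValNat_le_of_between {a i k : ℕ} (h1 : a * 2 ^ (i + 1) < k)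
    (h2 : k < (a + 1) * 2 ^ (i + 1)) : padicValNat 2 k ≤ i := by
  by_contra hcon
  obtain ⟨d, rfl⟩ := (padicValNat_dvd_iff_le (p := 2) (by omega : k ≠ 0)).2 (not_le.1 hcon)
  rw [mul_comm _ d] at h1 h2
  have h3 := lt_of_mul_lt_mul_right h1 (by positivity)
  have h4 := lt_of_mul_lt_mul_right h2 (by positivity)
  omega

theorem mem_rulerHistogram {m : ℕ} {p : ℝ × ℝ} {j : ℕ} (hj : j < m) (h1 : (j : ℝ) ≤ p.1)
    (h2 : p.1 ≤ j + 1) (h3 : (padicValNat 2 (j + 1) : ℝ) ≤ p.2) (h4 : p.2 ≤ m) :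
    p ∈ rulerHistogram m := mem_columnRegion.2 ⟨j, hj, ⟨h1, h2⟩, h3, h4⟩

/-- Above the height `i`, the histogram contains the whole width of each dyadic block of size
`2 ^ (i + 1)`. -/
theorem mem_rulerHistogram_of_block {m a i : ℕ} (ha : (a + 1) * 2 ^ (i + 1) ≤ m + 1) {p : ℝ × ℝ}
    (h1 : ((a * 2 ^ (i + 1) : ℕ) : ℝ) ≤ p.1) (h2 : p.1 ≤ ((a + 1) * 2 ^ (i + 1) : ℕ) - 1)
    (h3 : (i : ℝ) ≤ p.2) (h4 : p.2 ≤ m) : p ∈ rulerHistogram m := by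
  obtain ⟨L, hL⟩ : ∃ L, L = a * 2 ^ (i + 1) := ⟨_, rfl⟩
  obtain ⟨N, hN⟩ : ∃ N, N = (a + 1) * 2 ^ (i + 1) := ⟨_, rfl⟩
  have hLN : L + 2 ≤ N := by
    have : 2 ^ (i + 1) = 2 * 2 ^ i := by ring
    have := Nat.one_le_two_pow (n := i)
    rw [hL, hN, add_mul, one_mul]
    omega
  rw [← hL] at h1
  rw [← hN] at h2 ha
  obtain ⟨j, hj1, hj2, hj3, hj4⟩ : ∃ j : ℕ, L ≤ j ∧ j + 1 < N ∧ (j : ℝ) ≤ p.1 ∧ p.1 ≤ j + 1 := by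
    have hp0 : 0 ≤ p.1 := (Nat.cast_nonneg L).trans h1
    rcases h2.lt_or_eq with h | h
    · refine ⟨⌊p.1⌋₊, Nat.le_floor h1, ?_, Nat.floor_le hp0, (Nat.lt_floor_add_one _).le⟩
      have : (⌊p.1⌋₊ : ℝ) + 1 < N := by linarith [Nat.floor_le hp0]
      exact_mod_cast this
    -- At the right end `p.1 = N - 1`, the column to the right may have a higher floor, so the
    -- column to the left is taken.
    · refine ⟨N - 2, by omega, by omega, ?_, ?_⟩ <;> rw [h, Nat.cast_sub (by omega)] <;>
        push_cast <;> linarith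
  refine mem_rulerHistogram (j := j) (by omega) hj3 hj4 (le_trans ?_ h3) h4
  exact_mod_cast padicValNat_le_of_between (a := a) (by omega) (by omega)

/-- Each dyadic block of size `2 ^ i` contains `i` guards with pairwise meeting visibility regions. -/
theorem exists_pairwise_conflict {m : ℕ} {G : Finset (ℝ × ℝ)} (hG : IsRGuardSet (rulerHistogram m) G)
    (i : ℕ) : ∀ a : ℕ, (a + 1) * 2 ^ i ≤ m + 1 → ∃ U ⊆ G, U.card = i ∧
      (∀ g ∈ U, ((a * 2 ^ i : ℕ) : ℝ) ≤ g.1 ∧ g.1 ≤ ((a + 1) * 2 ^ i : ℕ) - 1) ∧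
      ∀ g ∈ U, ∀ g' ∈ U, g ≠ g' →
        (rVisible (rulerHistogram m) g ∩ rVisible (rulerHistogram m) g').Nonempty := by
  induction i with
  | zero => exact fun a _ => ⟨∅, by simp, by simp, by simp, by simp⟩
  | succ i ih =>
    intro a ha
    -- Counting columns from 1, `c` is the middle one of the block, the only one with floor height
    -- `i`; `L` and `N` are the positions that bound the block.
    obtain ⟨c, hc⟩ : ∃ c, c = (2 * a + 1) * 2 ^ i := ⟨_, rfl⟩
    obtain ⟨L, hL⟩ : ∃ L, L = a * 2 ^ (i + 1) := ⟨_, rfl⟩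
    obtain ⟨N, hN⟩ : ∃ N, N = (a + 1) * 2 ^ (i + 1) := ⟨_, rfl⟩
    have hpow : 1 ≤ 2 ^ i := Nat.one_le_two_pow
    have hcL : c = L + 2 ^ i := by rw [hc, hL]; ring
    have hNc : N = c + 2 ^ i := by rw [hc, hN]; ring
    have hNm : N ≤ m + 1 := hN ▸ ha
    have him : i < m := by
      have := Nat.lt_two_pow_self (n := i)
      omega
    have hvc : padicValNat 2 (c - 1 + 1) = i := by
      rw [Nat.sub_add_cancel (by omega), hc, padicValNat.mul (by omega) (by positivity),
        padicValNat.prime_pow, padicValNat.eq_zero_of_not_dvd (by omega), zero_add]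
    have hc1 : ((c - 1 : ℕ) : ℝ) = c - 1 := by
      rw [Nat.cast_sub (by omega)]
      simp
    have hqP : ((c : ℝ) - 1 / 2, (i : ℝ)) ∈ rulerHistogram m := by
      refine mem_rulerHistogram (j := c - 1) (by omega) ?_ ?_ ?_ ?_
      · rw [hc1]
        simp only
        linarith
      · rw [hc1]
        simp only
        linarith
      · rw [hvc]
      · simp only
        exact_mod_cast him.le
    have hq := hqP
    rw [← hG.2, Set.mem_iUnion₂] at hq
    obtain ⟨g, hg, -, hrect⟩ := hq
    have hgP : g ∈ rulerHistogram m := hG.1 hg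
    have hgb := bounds_of_mem_columnRegion hgP
    have hfloor : ∀ {x : ℝ} {y : ℝ} {k : ℕ}, 1 ≤ k → (k : ℝ) - 1 < x → x < k →
        (x, y) ∈ rulerHistogram m → (padicValNat 2 k : ℝ) ≤ y := by
      intro x y k hk h1 h2 h
      have h3 : ((k - 1 : ℕ) : ℝ) = k - 1 := by
        rw [Nat.cast_sub hk]
        simp
      have := (floor_le_of_mem_columnRegion h (j := k - 1) (by rw [h3]; exact h1)
        (by rw [h3]; simpa using h2)).2
      simpa only [Nat.sub_add_cancel hk] using this
    -- The spanned rectangle contains the point of column `c` at the height of `g`, which cannot be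
    -- below the floor.
    have hgi : (i : ℝ) ≤ g.2 := by
      have h1 := hfloor (k := c) (by omega) (by linarith) (by linarith)
        (hrect (show ((c : ℝ) - 1 / 2, g.2) ∈ _ from ⟨by simp, by simp⟩))
      rwa [hc, padicValNat.mul (by omega) (by positivity), padicValNat.prime_pow,
        padicValNat.eq_zero_of_not_dvd (by omega), zero_add] at h1
    -- The floors at multiples of `2 ^ (i + 1)` are higher than `i`, so the rectangle, which reaches
    -- down to height `i`, cannot enter those columns. This confines `g` to the block.
    have hhigh : ∀ {x : ℝ} {k d : ℕ}, k = d * 2 ^ (i + 1) → 1 ≤ k →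
        x ∈ Set.uIcc g.1 ((c : ℝ) - 1 / 2) → (k : ℝ) - 1 < x → x < k → False := by
      intro x k d hkd hk hx h1 h2
      have h3 := hfloor hk h1 h2 (hrect (show (x, (i : ℝ)) ∈ _ from ⟨hx, by simp⟩))
      have h3 : padicValNat 2 k ≤ i := by exact_mod_cast h3
      have h4 := (padicValNat_dvd_iff_le (p := 2) (by omega : k ≠ 0)).1 (Dvd.intro_left d hkd.symm)
      omega
    have hcL' : (L : ℝ) + 1 ≤ c := by exact_mod_cast (by omega : L + 1 ≤ c)
    have hNc' : (c : ℝ) + 1 ≤ N := by exact_mod_cast (by omega : c + 1 ≤ N)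
    have hgL : (L : ℝ) ≤ g.1 := by
      by_contra hcon
      push Not at hcon
      have hL1 : 1 ≤ L := by
        rcases Nat.eq_zero_or_pos L with h | h
        · rw [h] at hcon
          exact absurd hgb.1.1 (not_le.2 (by simpa using hcon))
        · exact h
      refine hhigh (x := max g.1 (L - 1 / 2)) hL hL1 ?_ ?_ ?_
      · rw [Set.mem_uIcc]
        exact .inl ⟨le_max_left _ _, max_le (by linarith) (by linarith)⟩
      · exact lt_max_of_lt_right (by linarith)
      · exact max_lt hcon (by linarith)
    have hgN : g.1 ≤ N - 1 := by
      by_contra hcon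
      push Not at hcon
      refine hhigh (x := min g.1 (N - 1 / 2)) hN (by omega) ?_ ?_ ?_
      · rw [Set.mem_uIcc]
        exact .inr ⟨le_min (by linarith) (by linarith), min_le_left _ _⟩
      · exact lt_min hcon (by linarith)
      · exact min_lt_of_right_lt (by linarith)
    obtain ⟨U, hUG, hUcard, hgU, hUb, hUconf⟩ : ∃ U ⊆ G, U.card = i ∧ g ∉ U ∧
        (∀ g ∈ U, (L : ℝ) ≤ g.1 ∧ g.1 ≤ N - 1) ∧ ∀ g ∈ U, ∀ g' ∈ U, g ≠ g' →
        (rVisible (rulerHistogram m) g ∩ rVisible (rulerHistogram m) g').Nonempty := by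
      -- The induction hypothesis is applied to the half block that does not contain `g`, so that
      -- `g` is a new guard.
      by_cases hgc : g.1 ≤ c - 1
      · have hN' : (2 * a + 1 + 1) * 2 ^ i = N := by rw [hN]; ring
        obtain ⟨U, h1, h2, h3, h4⟩ := ih (2 * a + 1) (by omega)
        rw [← hc, hN'] at h3
        exact ⟨U, h1, h2, fun hgU => by linarith [(h3 g hgU).1],
          fun g hg => ⟨by linarith [(h3 g hg).1], (h3 g hg).2⟩, h4⟩
      · have hL' : 2 * a * 2 ^ i = L := by rw [hL]; ring
        obtain ⟨U, h1, h2, h3, h4⟩ := ih (2 * a) (by omega)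
        rw [← hc, hL'] at h3
        exact ⟨U, h1, h2, fun hgU => hgc (h3 g hgU).2,
          fun g hg => ⟨(h3 g hg).1, by linarith [(h3 g hg).2]⟩, h4⟩
    have hnew : ∀ g' ∈ U,
        (rVisible (rulerHistogram m) g ∩ rVisible (rulerHistogram m) g').Nonempty := by
      intro g' hg'
      obtain ⟨j, hj, hj1, hj2⟩ := mem_columnRegion.1 (hG.1 (hUG hg'))
      -- Both guards see the ceiling point above `g'`: the guard `g` because it is above all floors
      -- of the block, and `g'` along its vertical line.
      have hsub : spannedRect g (g'.1, (m : ℝ)) ⊆ rulerHistogram m := by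
        rintro ⟨x, y⟩ ⟨hx, hy⟩
        simp only [Set.mem_uIcc] at hx hy
        have hb := hUb g' hg'
        have hgm : g.2 ≤ m := hgb.2
        refine mem_rulerHistogram_of_block ha ?_ ?_ ?_ ?_
        · rw [← hL]
          rcases hx with hx | hx <;> simp only <;> linarith
        · rw [← hN]
          rcases hx with hx | hx <;> simp only <;> linarith
        · rcases hy with hy | hy <;> simp only <;> linarith
        · rcases hy with hy | hy <;> simp only <;> linarith
      have hsub' : spannedRect g' (g'.1, (m : ℝ)) ⊆ rulerHistogram m := by
        rintro ⟨x, y⟩ ⟨hx, hy⟩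
        simp only [Set.uIcc_self, Set.mem_singleton_iff] at hx
        rw [Set.uIcc_of_le hj2.2] at hy
        subst hx
        exact mem_rulerHistogram hj hj1.1 hj1.2 (hj2.1.trans hy.1) hy.2
      have hmem := hsub' (right_mem_spannedRect _ _)
      exact ⟨_, ⟨hmem, hsub⟩, hmem, hsub'⟩
    refine ⟨insert g U, Finset.insert_subset hg hUG, by rw [Finset.card_insert_of_notMem hgU, hUcard],
      ?_, ?_⟩
    · rw [← hL, ← hN]
      intro g' hg'
      rcases Finset.mem_insert.1 hg' with rfl | h
      · exact ⟨hgL, hgN⟩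
      · exact hUb g' h
    · intro g₁ h1 g₂ h2 hne
      rcases Finset.mem_insert.1 h1 with e1 | h1'
      · rcases Finset.mem_insert.1 h2 with e2 | h2'
        · exact absurd (e1.trans e2.symm) hne
        · exact e1 ▸ hnew g₂ h2'
      · rcases Finset.mem_insert.1 h2 with e2 | h2'
        · rw [Set.inter_comm, e2]
          exact hnew g₁ h1'
        · exact hUconf g₁ h1' g₂ h2' hne

/-- The ruler histogram needs logarithmically many colors. -/
theorem le_of_hasStrongChromaticRGuarding_rulerHistogram {m t K : ℕ} (hK : 2 ^ K ≤ m + 1)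
    (h : HasStrongChromaticRGuarding (rulerHistogram m) t) : K ≤ t := by
  obtain ⟨G, γ, hG, hγ⟩ := h
  obtain ⟨U, hUG, hcard, -, hconf⟩ := exists_pairwise_conflict hG K 0 (by simpa using hK)
  have hinj : Function.Injective fun g : U => γ ⟨g, hUG g.2⟩ := by
    intro g g' hgg
    by_contra hne
    have hne' : (g : ℝ × ℝ) ≠ g' := fun h => hne (Subtype.ext h)
    exact hγ ⟨g, hUG g.2⟩ ⟨g', hUG g'.2⟩ (fun h => hne' (Subtype.mk.inj h))
      (hconf g g.2 g' g'.2 hne') hgg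
  have := Fintype.card_le_of_injective _ hinj
  simpa [hcard] using this

/-! ### Numerical constants and the theorem. -/

/-- From `2 * n + 1 ≤ n ^ 2` and `2 / log 2 < 3`, the binary logarithm is at most `3 * log n`. Since
`log n ≥ 1`, the total `18 * log n + 7` is at most `25 * log n`. -/
theorem color_bound {n : ℕ} (hn : 4 ≤ n) :
    ((6 * (Nat.log 2 (2 * n + 1) + 1) + 1 : ℕ) : ℝ) ≤ 25 * Real.log n := by
  have hn' : (4 : ℝ) ≤ n := by exact_mod_cast hn
  have hlog1 : 1 ≤ Real.log n := by
    rw [Real.le_log_iff_exp_le (by linarith)]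
    linarith [Real.exp_one_lt_d9]
  have hlog : (Nat.log 2 (2 * n + 1) : ℝ) ≤ 3 * Real.log n := by
    have h1 : ((2 ^ Nat.log 2 (2 * n + 1) : ℕ) : ℝ) ≤ (2 * n + 1 : ℕ) := by
      exact_mod_cast Nat.pow_log_le_self 2 (by omega)
    have h2 : (((2 * n + 1 : ℕ) : ℝ)) ≤ (n : ℝ) ^ 2 := by
      push_cast
      nlinarith
    have h3 := Real.log_le_log (by positivity) (h1.trans h2)
    rw [Nat.cast_pow, Real.log_pow, Real.log_pow, Nat.cast_ofNat] at h3
    have h4 := Real.log_two_gt_d9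
    have h5 : (0 : ℝ) ≤ Nat.log 2 (2 * n + 1) := Nat.cast_nonneg _
    nlinarith
  push_cast
  linarith

/-- With `K` the binary logarithm of `n / 2`, one has `n ≤ 2 ^ (K + 2)`, and `K + 2 ≤ 3 * K` as `K ≥
1`. -/
theorem log_le_three_mul_log_half {n : ℕ} (hn : 4 ≤ n) :
    1 / 3 * Real.log n ≤ (Nat.log 2 (n / 2) : ℝ) := by
  set K := Nat.log 2 (n / 2) with hK
  have hK1 : 1 ≤ K := Nat.le_log_of_pow_le (by norm_num) (by omega)
  have h1 : n / 2 < 2 ^ (K + 1) := Nat.lt_pow_succ_log_self (by norm_num) _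
  have h2 : n ≤ 2 ^ (K + 2) := by
    have : 2 ^ (K + 2) = 2 * 2 ^ (K + 1) := by ring
    omega
  have h3 : (n : ℝ) ≤ 2 ^ (K + 2) := by exact_mod_cast h2
  have hn' : (0 : ℝ) < n := by exact_mod_cast (by omega : 0 < n)
  have h4 := Real.log_le_log hn' h3
  rw [Real.log_pow] at h4
  push_cast at h4
  have h5 := Real.log_two_lt_d9
  have h6 : (1 : ℝ) ≤ K := by exact_mod_cast hK1
  nlinarith

theorem mainTheorem4 :
    ∃ c C : ℝ, 0 < c ∧ 0 < C ∧
      (∀ (n : ℕ) (P : Set (ℝ × ℝ)), IsSimpleOrthogonalPolygon P n →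
        ∃ t : ℕ, (t : ℝ) ≤ C * Real.log n ∧ HasStrongChromaticRGuarding P t) ∧
      (∀ n : ℕ, 4 ≤ n → Even n →
        ∃ k : ℕ, maxStrongChromaticNumber n = (k : ℕ∞) ∧
          c * Real.log n ≤ (k : ℝ) ∧ (k : ℝ) ≤ C * Real.log n) := by
  refine ⟨1 / 3, 25, by norm_num, by norm_num, fun n P hP => ?_, fun n hn he => ?_⟩
  · obtain ⟨-, -, v, hv, -⟩ := id hP
    exact ⟨_, color_bound hv.four_le, hP.hasStrongChromaticRGuarding⟩
  · set t := 6 * (Nat.log 2 (2 * n + 1) + 1) + 1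
    have hle : maxStrongChromaticNumber n ≤ (t : ℕ∞) := iSup₂_le fun P hP =>
      iInf₂_le t hP.hasStrongChromaticRGuarding
    obtain ⟨k, hk⟩ := ENat.ne_top_iff_exists.1 (ne_top_of_le_ne_top (ENat.natCast_ne_top t) hle)
    have hge : ((Nat.log 2 (n / 2) : ℕ) : ℕ∞) ≤ maxStrongChromaticNumber n := by
      obtain ⟨r, hr⟩ := he
      -- A histogram with `m` columns has `2 * m + 2` vertices.
      have hpoly := isSimpleOrthogonalPolygon_rulerHistogram (m := n / 2 - 1) (by omega)
      rw [show 2 * (n / 2 - 1) + 2 = n by omega] at hpoly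
      refine le_iSup₂_of_le (rulerHistogram (n / 2 - 1)) hpoly (le_iInf₂ fun t ht => ?_)
      refine Nat.cast_le.2 (le_of_hasStrongChromaticRGuarding_rulerHistogram ?_ ht)
      rw [Nat.sub_add_cancel (by omega)]
      exact Nat.pow_log_le_self 2 (by omega)
    rw [← hk, Nat.cast_le] at hle hge
    refine ⟨k, hk.symm, ?_, ?_⟩
    · exact (log_le_three_mul_log_half hn).trans (by exact_mod_cast hge)
    · exact le_trans (by exact_mod_cast hle) (color_bound hn)
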